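/- Let $\mathbf F\in\{\mathbf R,\mathbf C\}$, let $d,m,n_1,\dots,n_m$ be positive integers, and let $\mathcal H_j=\mathbf F^{n_j}$ and $\mathcal H=\bigotimes_{j=1}^m\mathcal H_j$ carry their Hilbert space norms. Let $\vec W=(W_1,\dots,W_m)$ be matrix weights, that is, $W_j:\mathbf R^d\to\mathbf F^{n_j\times n_j}$ is measurable and a.e. Hermitian positive definite, and put $\mathbf W:=\bigotimes_{j=1}^mW_j$. Cubes have sides parallel to the axes, $\frac1p:=\sum_j\frac1{p_j}$, $\frac1r:=\sum_j\frac1{r_j}$, $\frac1\infty:=0$, and averages with an infinite exponent are read as essential suprema. For a scalar weight $w$ on $\mathbf R^d$ and $\kappa\in[1,\infty]$, let $[w]_\kappa:=\sup_Q\big(\frac1{|Q|}\int_Q w^\kappa\,\mathrm dx\big)^{1/\kappa}\big(\frac1{|Q|}\int_Q w^{-\kappa'}\,\mathrm dx\big)^{1/\kappa'}$. For a nonnegative weight $v$ let $[v]_{\mathrm{FW}}:=\sup_Q\frac{1}{v(Q)}\int_QM^{\mathcal D(Q)}v\,\mathrm dx$, where $v(Q):=\int_Qv\,\mathrm dx$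 and $M^{\mathcal D(Q)}v(x)$ is the supremum of the averages of $v$ over the dyadic subcubes of $Q$ containing $x$. For a matrix weight $W$ on a Hilbert space $\mathcal V$ and $0<q<\infty$ let $[W]_{\mathrm{FW}_q}:=\sup_{v\in\mathcal V\setminus\{0\}}[\|Wv\|^q]_{\mathrm{FW}}^{1/q}$. (A) Let $\vec p\in(0,\infty]^m$, $\vec r\in(0,\infty)^m$, $s\in(\mathbf R\setminus\{0\})\cup\{\infty\}$ with $p_j\ge r_j$ for all $j$, $\frac1p\ge\frac1s$ and $r\ne s$. Put $$\frac1q:=\frac1p-\frac1s,\quad \frac1\rho:=\frac1r-\frac1s,\quad \frac1\kappa:=\frac{\frac1p-\frac1s}{\frac1r-\frac1s},\quad \frac1{t_j}:=\frac1{r_j}-\frac1{p_j},\quad \lambda_j:=t_j\Big(\frac1r-\frac1s\Big),$$ $$[\vec W]_{\vec p,(\vec r,s),\mathrm{op}}:=\sup_Q\Big(\frac1{|Q|}\int_Q\prod_{j=1}^m\Big(\frac1{|Q|}\int_Q\|W_j(x)W_j(x_j)^{-1}\|^{t_j}\,\mathrm dx_j\Big)^{q/t_j}\mathrm dx\Big)^{1/q},$$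 and assume that this quantity is finite. Then $$\sup_{v\in\mathcal H\setminus\{0\}}\big[\|\mathbf Wv\|^\rho\big]_\kappa^{1/\rho}\le[\vec W]_{\vec p,(\vec r,s),\mathrm{op}},\qquad \sup_{v\in\mathcal H_j\setminus\{0\}}\big[\|W_j^{-1}v\|^\rho\big]_{\lambda_j}^{1/\rho}\lesssim_{m,\vec r,s,\vec n}[\vec W]_{\vec p,(\vec r,s),\mathrm{op}}\quad(1\le j\le m),$$ $$[\mathbf W]_{\mathrm{FW}_q}\lesssim_{r,s,p}[\vec W]_{\vec p,(\vec r,s),\mathrm{op}}\ \text{ if }p\ne s,\qquad [W_j^{-1}]_{\mathrm{FW}_{t_j}}\lesssim_{m,\vec r,s,\vec n,p_j}[\vec W]_{\vec p,(\vec r,s),\mathrm{op}}\ \text{ if }p_j\ne r_j\quad(1\le j\le m).$$ (B) Let $\vec p\in[1,\infty]^m$ and write $[\vec W]_{\vec p,\mathrm{op}}$ for the quantity in (A) with $\vec r=(1,\dots,1)$, $s=\infty$ (so $q=p$, $t_j=p_j'$). Suppose that $\vec W\in A_{\vec p}$: each $W_j^{-1}$ is locally $p_j'$-integrable, and the averaging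 operators $T_Q(f_1,\dots,f_m):=\mathbf 1_Q\bigotimes_j\frac1{|Q|}\int_Qf_j\,\mathrm dx$ are bounded, uniformly over all cubes $Q$, from $L^{p_1}_{W_1}\times\cdots\times L^{p_m}_{W_m}$ to $L^p_{\mathbf W}$, where $\|f\|_{L^p_W}:=\big\|\|Wf\|\big\|_{L^p(\mathbf R^d)}$. Then $[\vec W]_{\vec p,\mathrm{op}}<\infty$ and $$\sup_{v\in\mathcal H\setminus\{0\}}\big[\|\mathbf Wv\|^{1/m}\big]_{mp}^{m}\le[\vec W]_{\vec p,\mathrm{op}},\qquad \sup_{v\in\mathcal H_j\setminus\{0\}}\big[\|W_j^{-1}v\|^{1/m}\big]_{mp_j'}^{m}\lesssim_{m,\vec n}[\vec W]_{\vec p,\mathrm{op}}\quad(1\le j\le m).$$ In particular, $\|\mathbf Wv\|^{1/m}\in A_{mp}$ and $\|W_j^{-1}v\|^{1/m}\in A_{mp_j'}$ uniformly in $v\neq0$. Moreover $$[\mathbf W]_{\mathrm{FW}_p}\lesssim_{m,p}[\vec W]_{\vec p,\mathrm{op}}\ \text{ if }p<\infty,\qquad [W_j^{-1}]_{\mathrm{FW}_{p_j'}}\lesssim_{d,m,\vec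 n,p_j}[\vec W]_{\vec p,\mathrm{op}}\ \text{ if }p_j>1\quad(1\le j\le m).$$ -/

import Mathlib

open MeasureTheory ENNReal
open scoped ComplexOrder

noncomputable section

namespace MatrixWeights

/-! ### Exponents -/

/-- The reciprocal `1 / p` of an exponent `p ∈ (0, ∞]`, as a real number (`1 / ∞ = 0`). -/
def invExp (p : ℝ≥0∞) : ℝ := (p⁻¹).toReal

/-- The reciprocal `1 / s` of `s ∈ (ℝ \ {0}) ∪ {∞}`, as a real number (`1 / ∞ = 0`). -/
def invTop : WithTop ℝ → ℝ
  | ⊤ => 0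
  | (s : ℝ) => s⁻¹

/-- The exponent in `(0, ∞]` whose reciprocal is the real number `a ≥ 0`. -/
def expOf (a : ℝ) : ℝ≥0∞ := (ENNReal.ofReal a)⁻¹

/-- The exponent `p` with `1 / p = ∑ j, 1 / p_j`. -/
def harm {m : ℕ} (p : Fin m → ℝ≥0∞) : ℝ≥0∞ := (∑ j, (p j)⁻¹)⁻¹

/-! ### Cubes -/

/-- The cube with lower corner `a` and side length `ℓ`, sides parallel to the axes. -/
def cube {d : ℕ} (a : Fin d → ℝ) (ℓ : ℝ) : Set (Fin d → ℝ) :=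
  Set.univ.pi fun i => Set.Ico (a i) (a i + ℓ)

/-- Normalised Lebesgue measure `dx / |Q|` on the cube `Q`. Thus `eLpNorm f t (avgMeasure a ℓ)` is
`(⨍_Q |f|^t)^(1/t)`, read as an essential supremum over `Q` if `t = ∞`. -/
def avgMeasure {d : ℕ} (a : Fin d → ℝ) (ℓ : ℝ) : Measure (Fin d → ℝ) :=
  (volume (cube a ℓ))⁻¹ • volume.restrict (cube a ℓ)

/-! ### Matrices and tensor products -/

section Matrices

variable {𝕜 : Type*} [RCLike 𝕜]

/-- The operator norm of a matrix on the Hilbert space `EuclideanSpace 𝕜 ι`. -/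
def opNorm {ι : Type*} [Fintype ι] [DecidableEq ι] (A : Matrix ι ι 𝕜) : ℝ≥0∞ :=
  ‖Matrix.toEuclideanCLM (n := ι) (𝕜 := 𝕜) A‖ₑ

/-- The Hilbert space norm `‖A v‖`. -/
def normMul {ι : Type*} [Fintype ι] [DecidableEq ι] (A : Matrix ι ι 𝕜)
    (v : EuclideanSpace 𝕜 ι) : ℝ≥0∞ :=
  ‖Matrix.toEuclideanCLM (n := ι) (𝕜 := 𝕜) A v‖ₑ

/-- The pure tensor `⨂ j, u_j`, in the Hilbert space tensor product of the `𝕜 ^ (n j)`, which is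
`EuclideanSpace` over the product of the index sets. -/
def tensorVec {m : ℕ} {n : Fin m → ℕ} (u : ∀ j, EuclideanSpace 𝕜 (Fin (n j))) :
    EuclideanSpace 𝕜 (∀ j, Fin (n j)) :=
  WithLp.toLp 2 fun a => ∏ j, u j (a j)

/-- The tensor product `⨂ j, A_j` of matrices. -/
def tensorMatrix {m : ℕ} {n : Fin m → ℕ} (A : ∀ j, Matrix (Fin (n j)) (Fin (n j)) 𝕜) :
    Matrix (∀ j, Fin (n j)) (∀ j, Fin (n j)) 𝕜 :=
  Matrix.of fun a b => ∏ j, A j (a j) (b j)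

/-- `⟨⨂ u_j, ⨂ v_j⟩ = ∏ ⟨u_j, v_j⟩`, the defining property of the inner product. -/
theorem inner_tensorVec {m : ℕ} {n : Fin m → ℕ} (u v : ∀ j, EuclideanSpace 𝕜 (Fin (n j))) :
    inner 𝕜 (tensorVec u) (tensorVec v) = ∏ j, inner 𝕜 (u j) (v j) := by
  simp only [PiLp.inner_apply, tensorVec, RCLike.inner_apply, map_prod,
    ← Finset.prod_mul_distrib]
  exact (Finset.prod_univ_sum (fun j => (Finset.univ : Finset (Fin (n j))))
    (fun j a => v j a * (starRingEnd 𝕜) (u j a))).symm ▸ by simp [Fintype.piFinset_univ]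

/-- `(⨂ A_j) (⨂ u_j) = ⨂ A_j u_j`, the defining property of the tensor product of operators. -/
theorem tensorMatrix_tensorVec {m : ℕ} {n : Fin m → ℕ}
    (A : ∀ j, Matrix (Fin (n j)) (Fin (n j)) 𝕜) (u : ∀ j, EuclideanSpace 𝕜 (Fin (n j))) :
    Matrix.toEuclideanCLM (n := ∀ j, Fin (n j)) (𝕜 := 𝕜) (tensorMatrix A) (tensorVec u) =
      tensorVec fun j => Matrix.toEuclideanCLM (n := Fin (n j)) (𝕜 := 𝕜) (A j) (u j) := by
  ext a
  simp only [tensorVec, tensorMatrix, Matrix.toEuclideanCLM_toLp, Matrix.ofLp_toEuclideanCLM,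
    Matrix.mulVec, dotProduct, Matrix.of_apply, ← Finset.prod_mul_distrib]
  exact (Finset.prod_univ_sum (fun j => (Finset.univ : Finset (Fin (n j))))
    (fun j b => A j (a j) b * (u j) b)).symm ▸ by simp [Fintype.piFinset_univ]

end Matrices

/-! ### Weights and Muckenhoupt characteristics -/

section Weights

variable {𝕜 : Type*} [RCLike 𝕜] {d : ℕ}

/-- A matrix weight: measurable, and Hermitian positive definite almost everywhere. -/
def IsMatrixWeight {ι : Type*} [Fintype ι] (W : (Fin d → ℝ) → Matrix ι ι 𝕜) : Prop :=
  (∀ a b, AEStronglyMeasurable (fun x => W x a b) volume) ∧ ∀ᵐ x ∂volume, (W x).PosDef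

/-- `sup_Q (⨍_Q ∏_j (⨍_Q ‖W_j(x) W_j(x_j)⁻¹‖^(t_j) dx_j)^(q/t_j) dx)^(1/q)`. -/
def opChar {m : ℕ} {n : Fin m → ℕ}
    (W : ∀ j, (Fin d → ℝ) → Matrix (Fin (n j)) (Fin (n j)) 𝕜)
    (t : Fin m → ℝ≥0∞) (q : ℝ≥0∞) : ℝ≥0∞ :=
  ⨆ (a : Fin d → ℝ) (ℓ : ℝ) (_ : 0 < ℓ),
    eLpNorm (fun x => ∏ j, eLpNorm (fun y => opNorm (W j x * (W j y)⁻¹)) (t j) (avgMeasure a ℓ))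
      q (avgMeasure a ℓ)

/-- `[W]_{p,(r,s),op}`, that is, `1/t_j = 1/r_j - 1/p_j` and `1/q = 1/p - 1/s`. -/
def opCharRS {m : ℕ} {n : Fin m → ℕ}
    (W : ∀ j, (Fin d → ℝ) → Matrix (Fin (n j)) (Fin (n j)) 𝕜)
    (p : Fin m → ℝ≥0∞) (r : Fin m → ℝ) (s : WithTop ℝ) : ℝ≥0∞ :=
  opChar W (fun j => expOf ((r j)⁻¹ - invExp (p j))) (expOf (invExp (harm p) - invTop s))

/-- `[W]_{p,op}`, the case `r = (1,…,1)`, `s = ∞`. -/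
def opCharP {m : ℕ} {n : Fin m → ℕ}
    (W : ∀ j, (Fin d → ℝ) → Matrix (Fin (n j)) (Fin (n j)) 𝕜)
    (p : Fin m → ℝ≥0∞) : ℝ≥0∞ :=
  opCharRS W p (fun _ => 1) ⊤

/-- The averaging operator `T_Q(f_1,…,f_m) = 1_Q ⨂_j ⨍_Q f_j` of the cube `Q`. -/
def avgOp {m : ℕ} {n : Fin m → ℕ} (a : Fin d → ℝ) (ℓ : ℝ)
    (f : ∀ j, (Fin d → ℝ) → EuclideanSpace 𝕜 (Fin (n j))) :
    (Fin d → ℝ) → EuclideanSpace 𝕜 (∀ j, Fin (n j)) :=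
  (cube a ℓ).indicator fun _ => tensorVec fun j => ⨍ y in cube a ℓ, f j y

/-- The weighted norm `‖f‖_{L^p_W} = ‖ ‖W f‖ ‖_{L^p}`. -/
def wNorm {ι : Type*} [Fintype ι] [DecidableEq ι] (W : (Fin d → ℝ) → Matrix ι ι 𝕜)
    (p : ℝ≥0∞) (f : (Fin d → ℝ) → EuclideanSpace 𝕜 ι) : ℝ≥0∞ :=
  eLpNorm (fun x => normMul (W x) (f x)) p volume

/-- The operator norm of `T_Q` from `L^{p_1}_{W_1} × ⋯ × L^{p_m}_{W_m}` to `L^p_𝐖`. -/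
def avgOpNorm {m : ℕ} {n : Fin m → ℕ}
    (W : ∀ j, (Fin d → ℝ) → Matrix (Fin (n j)) (Fin (n j)) 𝕜)
    (p : Fin m → ℝ≥0∞) (a : Fin d → ℝ) (ℓ : ℝ) : ℝ≥0∞ :=
  sInf {C : ℝ≥0∞ | ∀ f : ∀ j, (Fin d → ℝ) → EuclideanSpace 𝕜 (Fin (n j)),
    (∀ j, AEStronglyMeasurable (f j) volume ∧ wNorm (W j) (p j) (f j) < ∞) →
      wNorm (fun x => tensorMatrix fun j => W j x) (harm p) (avgOp a ℓ f) ≤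
        C * ∏ j, wNorm (W j) (p j) (f j)}

/-- The multilinear matrix Muckenhoupt condition: `W_j⁻¹` is locally `p_j'`-integrable for all `j`,
and the averaging operators over cubes are uniformly bounded. -/
def IsMuckenhoupt {m : ℕ} {n : Fin m → ℕ}
    (W : ∀ j, (Fin d → ℝ) → Matrix (Fin (n j)) (Fin (n j)) 𝕜) (p : Fin m → ℝ≥0∞) : Prop :=
  (∀ j (a : Fin d → ℝ) (ℓ : ℝ), 0 < ℓ →
    eLpNorm (fun x => opNorm ((W j x)⁻¹)) (p j).conjExponent (volume.restrict (cube a ℓ)) < ∞) ∧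
  (⨆ (a : Fin d → ℝ) (ℓ : ℝ) (_ : 0 < ℓ), avgOpNorm W p a ℓ) < ∞

/-- The scalar Muckenhoupt characteristic
`[w]_κ = sup_Q (⨍_Q w^κ)^(1/κ) (⨍_Q w^(-κ'))^(1/κ')`, for `1 ≤ κ ≤ ∞`. -/
def scalarChar (w : (Fin d → ℝ) → ℝ≥0∞) (κ : ℝ≥0∞) : ℝ≥0∞ :=
  ⨆ (a : Fin d → ℝ) (ℓ : ℝ) (_ : 0 < ℓ),
    eLpNorm w κ (avgMeasure a ℓ) *
      eLpNorm (fun x => (w x)⁻¹) κ.conjExponent (avgMeasure a ℓ)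

/-! ### The Fujii–Wilson constant -/

/-- The maximal operator over the dyadic subcubes of the cube with corner `a` and side `ℓ`: the
subcubes of generation `k` are obtained by cutting each side into `2 ^ k` equal pieces. -/
def dyadicMax (a : Fin d → ℝ) (ℓ : ℝ) (v : (Fin d → ℝ) → ℝ≥0∞) (x : Fin d → ℝ) : ℝ≥0∞ :=
  ⨆ (k : ℕ) (i : Fin d → Fin (2 ^ k)),
    (cube (fun c => a c + (i c : ℕ) * (ℓ / 2 ^ k)) (ℓ / 2 ^ k)).indicator
      (fun _ => ⨍⁻ y in cube (fun c => a c + (i c : ℕ) * (ℓ / 2 ^ k)) (ℓ / 2 ^ k), v y ∂volume) x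

/-- `[v]_FW = sup_Q v(Q)⁻¹ ∫_Q M^{𝒟(Q)} v`. -/
def fujiiWilson (v : (Fin d → ℝ) → ℝ≥0∞) : ℝ≥0∞ :=
  ⨆ (a : Fin d → ℝ) (ℓ : ℝ) (_ : 0 < ℓ),
    (∫⁻ x in cube a ℓ, dyadicMax a ℓ v x) / ∫⁻ x in cube a ℓ, v x

/-- `[W]_{FW_q} = sup_{v ≠ 0} [‖W v‖^q]_FW^(1/q)`, for `0 < q < ∞`. -/
def matrixFW {ι : Type*} [Fintype ι] [DecidableEq ι] (W : (Fin d → ℝ) → Matrix ι ι 𝕜)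
    (q : ℝ≥0∞) : ℝ≥0∞ :=
  ⨆ (v : EuclideanSpace 𝕜 ι) (_ : v ≠ 0),
    fujiiWilson (fun x => normMul (W x) v ^ q.toReal) ^ (q.toReal)⁻¹

/-- `sup_{v ≠ 0} [‖W v‖^ρ]_κ^(1/ρ)`. -/
def directionalChar {ι : Type*} [Fintype ι] [DecidableEq ι] (W : (Fin d → ℝ) → Matrix ι ι 𝕜)
    (ρ : ℝ) (κ : ℝ≥0∞) : ℝ≥0∞ :=
  ⨆ (v : EuclideanSpace 𝕜 ι) (_ : v ≠ 0),
    scalarChar (fun x => normMul (W x) v ^ ρ) κ ^ ρ⁻¹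

end Weights

end MatrixWeights

end

noncomputable section

namespace MatrixWeights

/-! ### Exponents given by their reciprocals -/

/-! Write b = 1/q and τ_j = 1/t_j for the reciprocals; then b + ∑ τ_j = 1/r - 1/s = 1/ρ. All bounds
come from two-weight products ‖w‖_{1/α} ‖w⁻¹‖_{1/β} of averaged quasinorms on one cube, with α + β =
1/ρ.

For w = ‖𝐖v‖, the tensor structure gives ‖𝐖(x)v‖ ≤ ∏ ‖W_j(x)W_j(y)⁻¹‖ · ‖𝐖(y)v‖. Divide by the last
factor, apply Hölder in y with reciprocal ∑ τ_j and take the norm in x with reciprocal b. For w =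
‖W_j⁻¹v‖, put h_i = ‖W_i⁻¹u_i‖ with u_j = v and any u_i ≠ 0 in the other slots. Since h_i(y) ≤
‖W_i(x)W_i(y)⁻¹‖ h_i(x), one gets ∏ ‖h_i‖_{t_i} · ‖∏ h_i⁻¹‖_q ≤ the characteristic, and Hölder
applied to h_j⁻¹ = ∏ h_i⁻¹ · ∏_{i≠j} h_i finishes. Both bounds have constant 1; raising w to the
power ρ makes the exponents conjugate. These are `eLpNorm_tensor_mul_eLpNorm_inv_le` and
`eLpNorm_inv_mul_eLpNorm_inv_le`.

The same products give a reverse Hölder inequality: 1 ≤ ‖w‖_{1/(2α)} ‖w⁻¹‖_{1/β}, hence ‖w‖_{1/α} ≤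
K ‖w‖_{1/(2α)}. With v = w^{1/α} this says Mv ≤ K^{1/α} (M v^{1/2})², and Doob's L² inequality, with
constant 4, yields the Fujii–Wilson bound (`fujiiWilson_rpow_le`).

In (B) the operator characteristic must be shown finite. On a cube, the averages of the unit ball of
L^{p_j}_{W_j} form a bounded spanning set, which has a near-Auerbach basis e_{j,1}, …, e_{j,n_j}. By
duality ∑_i ‖W_j(x)e_{j,i}‖ controls the averaged norm of W_j(x)W_j(y)⁻¹ at almost every x
simultaneously. Multiplying over j leaves finitely many terms ‖𝐖(x) ⨂ e_{j,i_j}‖, each the value of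
T_Q on a tuple of unit functions. -/

theorem expOf_zero : expOf 0 = ∞ := by simp [expOf]

theorem expOf_of_pos {a : ℝ} (ha : 0 < a) : expOf a = ENNReal.ofReal a⁻¹ := by
  rw [expOf, ENNReal.ofReal_inv_of_pos ha]

theorem expOf_ne_zero (a : ℝ) : expOf a ≠ 0 := by simp [expOf]

theorem toReal_expOf {a : ℝ} (ha : 0 ≤ a) : (expOf a).toReal = a⁻¹ := by
  rw [expOf, ENNReal.toReal_inv, ENNReal.toReal_ofReal ha]

theorem expOf_invExp {p : ℝ≥0∞} (hp : p ≠ 0) : expOf (invExp p) = p := by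
  rw [expOf, invExp, ENNReal.ofReal_toReal (by simpa using hp), inv_inv]

theorem invExp_nonneg (p : ℝ≥0∞) : 0 ≤ invExp p := ENNReal.toReal_nonneg

theorem invExp_harm {m : ℕ} {p : Fin m → ℝ≥0∞} (hp : ∀ j, p j ≠ 0) :
    invExp (harm p) = ∑ j, invExp (p j) := by
  rw [invExp, harm, inv_inv, ENNReal.toReal_sum (fun j _ => by simpa using hp j)]
  rfl

theorem harm_ne_zero {m : ℕ} {p : Fin m → ℝ≥0∞} (hp : ∀ j, p j ≠ 0) : harm p ≠ 0 := by
  simp [harm, ENNReal.sum_eq_top, hp]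

theorem expOf_mul_ofReal {a b : ℝ} (hb : 0 < b) :
    expOf (a * b) * ENNReal.ofReal b = expOf a := by
  have h : ENNReal.ofReal b ≠ 0 := by simpa using hb
  rw [expOf, expOf, ENNReal.ofReal_mul' hb.le,
    ENNReal.mul_inv (Or.inr ENNReal.ofReal_ne_top) (Or.inr h), mul_assoc,
    ENNReal.inv_mul_cancel h ENNReal.ofReal_ne_top, mul_one]

theorem conjExponent_expOf {c : ℝ} (h0 : 0 ≤ c) (h1 : c ≤ 1) :
    (expOf c).conjExponent = expOf (1 - c) := by
  have hc : ENNReal.ofReal c ≤ 1 := by simpa using ENNReal.ofReal_le_ofReal h1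
  have h : (expOf c).HolderConjugate (expOf (1 - c)) := by
    rw [ENNReal.holderConjugate_iff, expOf, expOf, inv_inv, inv_inv,
      ← ENNReal.ofReal_add h0 (by linarith)]
    simp
  exact h.conjExponent_eq

/-! ### `L^p` quasinorms of functions with values in `[0, ∞]` -/

section Quasinorms

variable {α : Type*} [MeasurableSpace α] {μ : Measure α} {f g : α → ℝ≥0∞}

theorem eLpNorm_expOf_zero (f : α → ℝ≥0∞) : eLpNorm f (expOf 0) μ = essSup f μ := by
  rw [expOf_zero, eLpNorm_exponent_top, eLpNormEssSup_eq_essSup_enorm]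
  rfl

theorem eLpNorm_expOf_of_pos {a : ℝ} (ha : 0 < a) (f : α → ℝ≥0∞) :
    eLpNorm f (expOf a) μ = (∫⁻ x, f x ^ a⁻¹ ∂μ) ^ a := by
  rw [eLpNorm_eq_lintegral_rpow_enorm_toReal (expOf_ne_zero a)
    (by simp [expOf, ha]), toReal_expOf ha.le]
  simp

theorem eLpNorm_const_mul {a : ℝ} (ha : 0 ≤ a) (c : ℝ≥0∞) (hf : AEMeasurable f μ) :
    eLpNorm (fun x => c * f x) (expOf a) μ = c * eLpNorm f (expOf a) μ := by
  rcases ha.eq_or_lt with rfl | ha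
  · simp_rw [eLpNorm_expOf_zero, ENNReal.essSup_const_mul]
  · simp_rw [eLpNorm_expOf_of_pos ha, ENNReal.mul_rpow_of_nonneg _ _ (inv_nonneg.2 ha.le)]
    rw [lintegral_const_mul'' _ (hf.pow_const _), ENNReal.mul_rpow_of_nonneg _ _ ha.le,
      ← ENNReal.rpow_mul, inv_mul_cancel₀ ha.ne', ENNReal.rpow_one]

theorem eLpNorm_rpow {a ρ : ℝ} (hρ : 0 < ρ) (f : α → ℝ≥0∞) :
    eLpNorm (fun x => f x ^ ρ) (expOf (a * ρ)) μ = eLpNorm f (expOf a) μ ^ ρ := by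
  have := eLpNorm_enorm_rpow (μ := μ) (p := expOf (a * ρ)) f hρ
  rw [expOf_mul_ofReal hρ] at this
  exact this

/-- Hölder in terms of reciprocals, valid for all exponents in (0, ∞], including those below 1. A
zero reciprocal is an essential supremum and is pulled out as a constant. -/
theorem eLpNorm_mul_le {a b : ℝ} (ha : 0 ≤ a) (hb : 0 ≤ b) (hf : AEMeasurable f μ)
    (hg : AEMeasurable g μ) :
    eLpNorm (fun x => f x * g x) (expOf (a + b)) μ ≤
      eLpNorm f (expOf a) μ * eLpNorm g (expOf b) μ := by
  rcases ha.eq_or_lt with rfl | ha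
  · rw [zero_add, ← eLpNorm_const_mul hb _ hg]
    refine eLpNorm_mono_enorm_ae ?_
    filter_upwards [ENNReal.ae_le_essSup f] with x hx
    rw [eLpNorm_expOf_zero]
    simpa using mul_le_mul_left hx (g x)
  rcases hb.eq_or_lt with rfl | hb
  · rw [add_zero, mul_comm, ← eLpNorm_const_mul ha.le _ hf]
    refine eLpNorm_mono_enorm_ae ?_
    filter_upwards [ENNReal.ae_le_essSup g] with x hx
    rw [eLpNorm_expOf_zero, mul_comm]
    simpa using mul_le_mul_left hx (f x)
  rw [eLpNorm_expOf_of_pos ha, eLpNorm_expOf_of_pos hb, eLpNorm_expOf_of_pos (add_pos ha hb)]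
  have := ENNReal.lintegral_Lp_mul_le_Lq_mul_Lr (p := (a + b)⁻¹) (q := a⁻¹) (r := b⁻¹)
    (by positivity) (inv_strictAnti₀ ha (by linarith)) (by simp) μ hf hg
  simpa using this

theorem eLpNorm_prod_le {ι : Type*} (s : Finset ι) {a : ι → ℝ}
    (ha : ∀ i, 0 ≤ a i) {f : ι → α → ℝ≥0∞} (hf : ∀ i, AEMeasurable (f i) μ) :
    eLpNorm (fun x => ∏ i ∈ s, f i x) (expOf (∑ i ∈ s, a i)) μ ≤
      ∏ i ∈ s, eLpNorm (f i) (expOf (a i)) μ := by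
  classical
  induction s using Finset.induction_on with
  | empty =>
    -- The empty sum of reciprocals is the exponent ∞, where the constant 1 has norm at most 1 for
    -- every measure.
    simp only [Finset.prod_empty, Finset.sum_empty, eLpNorm_expOf_zero]
    exact essSup_le_of_ae_le _ (Filter.Eventually.of_forall fun _ => le_rfl)
  | insert i s hi ih =>
    simp only [Finset.prod_insert hi, Finset.sum_insert hi]
    refine (eLpNorm_mul_le (ha i) (Finset.sum_nonneg fun i _ => ha i) (hf i)
      (Finset.aemeasurable_fun_prod s fun i _ => hf i)).trans ?_
    gcongr

/-- The harmonic mean p may be below 1, so each addition costs `LpAddConst`. The constant is chosen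
before the measure and the functions, hence is the same for all cubes. -/
theorem exists_eLpNorm_sum_le (a : ℝ) {ι : Type*} (s : Finset ι) :
    ∃ C : ℝ≥0∞, C ≠ ∞ ∧ ∀ (β : Type) [MeasurableSpace β] (ν : Measure β) (f : ι → β → ℝ≥0∞)
      (_ : ∀ i, AEMeasurable (f i) ν) (K : ℝ≥0∞) (_ : ∀ i, eLpNorm (f i) (expOf a) ν ≤ K),
      eLpNorm (fun x => ∑ i ∈ s, f i x) (expOf a) ν ≤ C * K := by
  classical
  induction s using Finset.induction_on with
  | empty => exact ⟨0, by simp, fun β _ ν f _ K _ => by simp⟩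
  | insert i s hi ih =>
    obtain ⟨C, hC, h⟩ := ih
    refine ⟨LpAddConst (expOf a) * (1 + C), ?_, fun β _ ν f hf K hK => ?_⟩
    · exact ENNReal.mul_ne_top (LpAddConst_lt_top _).ne (by finiteness)
    simp only [Finset.sum_insert hi]
    refine (eLpNorm_add_le' (hf i).aestronglyMeasurable
      (Finset.aemeasurable_fun_sum s fun i _ => hf i).aestronglyMeasurable _).trans ?_
    rw [mul_assoc, add_mul, one_mul]
    gcongr
    · exact hK i
    · exact h β ν f hf K hK

end Quasinorms

/-! ### Cubes and their dyadic children -/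

section Cubes

variable {d : ℕ}

theorem measurableSet_cube (a : Fin d → ℝ) (ℓ : ℝ) : MeasurableSet (cube a ℓ) :=
  MeasurableSet.univ_pi fun _ => measurableSet_Ico

theorem volume_cube (a : Fin d → ℝ) (ℓ : ℝ) : volume (cube a ℓ) = ENNReal.ofReal ℓ ^ d := by
  simp [cube, volume_pi_pi]

theorem volume_cube_ne_zero (a : Fin d → ℝ) {ℓ : ℝ} (hℓ : 0 < ℓ) : volume (cube a ℓ) ≠ 0 := by
  simp [volume_cube, hℓ]

theorem volume_cube_ne_top (a : Fin d → ℝ) (ℓ : ℝ) : volume (cube a ℓ) ≠ ∞ := by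
  simp [volume_cube]

theorem laverage_mul_volume_cube (a : Fin d → ℝ) {ℓ : ℝ} (hℓ : 0 < ℓ) (f : (Fin d → ℝ) → ℝ≥0∞) :
    (⨍⁻ y in cube a ℓ, f y ∂volume) * volume (cube a ℓ) = ∫⁻ x in cube a ℓ, f x := by
  rw [setLAverage_eq, ENNReal.div_mul_cancel (volume_cube_ne_zero a hℓ) (volume_cube_ne_top a ℓ)]

/-- Follows from f ≤ f² + 1. Finiteness of the average is what permits cancellation in the Bellman
argument. -/
theorem laverage_ne_top_of_sq (a : Fin d → ℝ) {ℓ : ℝ} (hℓ : 0 < ℓ) {f : (Fin d → ℝ) → ℝ≥0∞}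
    (hF : ∫⁻ x in cube a ℓ, f x ^ 2 ≠ ∞) : ⨍⁻ y in cube a ℓ, f y ∂volume ≠ ∞ := by
  intro hA
  have h1 : ∫⁻ x in cube a ℓ, f x ≤ (∫⁻ x in cube a ℓ, f x ^ 2) + volume (cube a ℓ) := by
    rw [← setLIntegral_one, ← lintegral_add_right' _ aemeasurable_const]
    refine lintegral_mono fun x => ?_
    rcases le_total (f x) 1 with h | h
    · exact h.trans le_add_self
    · refine le_trans ?_ le_self_add
      simpa [sq] using mul_le_mul_left h (f x)
  rw [← laverage_mul_volume_cube a hℓ, hA, ENNReal.top_mul (volume_cube_ne_zero a hℓ),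
    top_le_iff] at h1
  exact ENNReal.add_ne_top.2 ⟨hF, volume_cube_ne_top a ℓ⟩ h1

theorem isProbabilityMeasure_avgMeasure (a : Fin d → ℝ) {ℓ : ℝ} (hℓ : 0 < ℓ) :
    IsProbabilityMeasure (avgMeasure a ℓ) :=
  ⟨by simp [avgMeasure, ENNReal.inv_mul_cancel (volume_cube_ne_zero a hℓ)
    (volume_cube_ne_top a ℓ)]⟩

theorem avgMeasure_absolutelyContinuous (a : Fin d → ℝ) (ℓ : ℝ) : avgMeasure a ℓ ≪ volume :=
  (Measure.smul_absolutelyContinuous).trans Measure.restrict_le_self.absolutelyContinuous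

theorem setLAverage_eq_lintegral_avgMeasure (a : Fin d → ℝ) (ℓ : ℝ) (f : (Fin d → ℝ) → ℝ≥0∞) :
    ⨍⁻ x in cube a ℓ, f x ∂volume = ∫⁻ x, f x ∂avgMeasure a ℓ := by
  simp [laverage, avgMeasure]

/-- The lower corners of the `2 ^ d` dyadic children of a cube. -/
def childCorner (a : Fin d → ℝ) (ℓ : ℝ) (e : Fin d → Fin 2) : Fin d → ℝ :=
  fun c => a c + (e c : ℕ) * (ℓ / 2)

theorem mem_cube {a : Fin d → ℝ} {ℓ : ℝ} {x : Fin d → ℝ} :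
    x ∈ cube a ℓ ↔ ∀ c, a c ≤ x c ∧ x c < a c + ℓ := by
  simp [cube]

theorem cube_childCorner_disjoint (a : Fin d → ℝ) {ℓ : ℝ} (_ : 0 < ℓ) {e e' : Fin d → Fin 2}
    {x : Fin d → ℝ} (h : x ∈ cube (childCorner a ℓ e) (ℓ / 2))
    (h' : x ∈ cube (childCorner a ℓ e') (ℓ / 2)) : e = e' := by
  funext c
  have h1 := mem_cube.1 h c
  have h2 := mem_cube.1 h' c
  simp only [childCorner] at h1 h2
  generalize e c = i at *
  generalize e' c = j at *
  fin_cases i <;> fin_cases j <;> first | rfl | (simp at h1 h2; linarith)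

theorem cube_eq_iUnion_children (a : Fin d → ℝ) {ℓ : ℝ} (hℓ : 0 < ℓ) :
    cube a ℓ = ⋃ e : Fin d → Fin 2, cube (childCorner a ℓ e) (ℓ / 2) := by
  ext x
  simp only [Set.mem_iUnion, mem_cube, childCorner]
  constructor
  · intro h
    refine ⟨fun c => if x c < a c + ℓ / 2 then 0 else 1, fun c => ?_⟩
    have := h c
    dsimp only
    split_ifs with hc
    · simp; constructor <;> linarith
    · simp; constructor <;> linarith
  · rintro ⟨e, h⟩ c
    have := h c
    generalize e c = i at this
    fin_cases i <;> simp at this <;> constructor <;> linarith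

theorem lintegral_cube_eq_sum (a : Fin d → ℝ) {ℓ : ℝ} (hℓ : 0 < ℓ) (f : (Fin d → ℝ) → ℝ≥0∞) :
    ∫⁻ x in cube a ℓ, f x = ∑ e, ∫⁻ x in cube (childCorner a ℓ e) (ℓ / 2), f x := by
  rw [cube_eq_iUnion_children a hℓ, lintegral_iUnion (fun e => measurableSet_cube _ _),
    tsum_fintype]
  intro e e' hee
  exact Set.disjoint_left.2 fun x h h' => hee (cube_childCorner_disjoint a hℓ h h')

end Cubes

/-! ### The dyadic maximal function -/

section DyadicMax

variable {d : ℕ}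

theorem two_mul_le_sq_add_sq (a b : ℝ≥0∞) : 2 * a * b ≤ a ^ 2 + b ^ 2 := by
  rcases eq_or_ne a ∞ with rfl | ha
  · simp
  rcases eq_or_ne b ∞ with rfl | hb
  · simp
  lift a to NNReal using ha
  lift b to NNReal using hb
  exact_mod_cast two_mul_le_add_sq a b

/-- The supremum of the averages over the dyadic subcubes of generation `k` containing `x`. -/
def levelAverage (k : ℕ) (a : Fin d → ℝ) (ℓ : ℝ) (v : (Fin d → ℝ) → ℝ≥0∞) (x : Fin d → ℝ) :
    ℝ≥0∞ :=
  ⨆ i : Fin d → Fin (2 ^ k),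
    (cube (fun c => a c + (i c : ℕ) * (ℓ / 2 ^ k)) (ℓ / 2 ^ k)).indicator
      (fun _ => ⨍⁻ y in cube (fun c => a c + (i c : ℕ) * (ℓ / 2 ^ k)) (ℓ / 2 ^ k), v y ∂volume) x

theorem levelAverage_zero_le (a : Fin d → ℝ) (ℓ : ℝ) (v : (Fin d → ℝ) → ℝ≥0∞) (x : Fin d → ℝ) :
    levelAverage 0 a ℓ v x ≤ ⨍⁻ y in cube a ℓ, v y ∂volume := by
  refine iSup_le fun i => Set.indicator_apply_le' (fun _ => ?_) (fun _ => by simp)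
  have : (fun c => a c + (i c : ℕ) * (ℓ / 2 ^ 0)) = a := by
    funext c
    simp
  rw [this]
  simp

/-- Division of the index by 2 ^ k splits it into the child (quotient) and the position inside that
child (remainder). -/
theorem levelAverage_succ_le (k : ℕ) (a : Fin d → ℝ) {ℓ : ℝ} (hℓ : 0 < ℓ)
    (v : (Fin d → ℝ) → ℝ≥0∞) (e : Fin d → Fin 2) {x : Fin d → ℝ}
    (hx : x ∈ cube (childCorner a ℓ e) (ℓ / 2)) :
    levelAverage (k + 1) a ℓ v x ≤ levelAverage k (childCorner a ℓ e) (ℓ / 2) v x := by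
  refine iSup_le fun i => ?_
  have hk : (0 : ℝ) < 2 ^ k := by positivity
  have hs : ℓ / 2 ^ (k + 1) = ℓ / 2 / 2 ^ k := by rw [pow_succ]; field_simp
  have hpos : 0 < ℓ / 2 / 2 ^ k := by positivity
  let e' : Fin d → Fin 2 := fun c => ⟨(i c : ℕ) / 2 ^ k, by
    exact Nat.div_lt_of_lt_mul ((i c).2.trans_eq (pow_succ _ _))⟩
  let i' : Fin d → Fin (2 ^ k) := fun c => ⟨(i c : ℕ) % 2 ^ k, Nat.mod_lt _ (by positivity)⟩
  have hcorner : (fun c => a c + (i c : ℕ) * (ℓ / 2 ^ (k + 1))) =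
      fun c => childCorner a ℓ e' c + (i' c : ℕ) * (ℓ / 2 / 2 ^ k) := by
    funext c
    have h : ((i c : ℕ) : ℝ) = (2 : ℝ) ^ k * (e' c : ℕ) + (i' c : ℕ) := by
      exact_mod_cast (Nat.div_add_mod (i c : ℕ) (2 ^ k)).symm
    rw [hs, h, childCorner]
    field_simp
    ring
  rw [hcorner, hs]
  refine Set.indicator_apply_le' (fun hx' => ?_) (fun _ => by simp)
  have hsub : x ∈ cube (childCorner a ℓ e') (ℓ / 2) := by
    refine mem_cube.2 fun c => ?_
    have h := mem_cube.1 hx' c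
    have h1 : ((i' c : ℕ) : ℝ) + 1 ≤ 2 ^ k := by exact_mod_cast (i' c).2
    have h2 : (0 : ℝ) ≤ (i' c : ℕ) := by positivity
    have h3 : (((i' c : ℕ) : ℝ) + 1) * (ℓ / 2 / 2 ^ k) ≤ ℓ / 2 := by
      calc _ ≤ 2 ^ k * (ℓ / 2 / 2 ^ k) := by gcongr
        _ = ℓ / 2 := by field_simp
    have h4 := mul_nonneg h2 hpos.le
    constructor <;> nlinarith [h.1, h.2]
  obtain rfl := cube_childCorner_disjoint a hℓ hsub hx
  refine le_trans ?_ (le_iSup _ i')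
  rw [Set.indicator_of_mem hx']

/-- The Bellman function inequality behind the `L²` bound of the dyadic maximal operator. -/
theorem lintegral_sup_levelAverage_sq_add_le {f : (Fin d → ℝ) → ℝ≥0∞} (hf : AEMeasurable f volume)
    (K : ℕ) (a : Fin d → ℝ) {ℓ : ℝ} (hℓ : 0 < ℓ) (l : ℝ≥0∞)
    (hl : ⨍⁻ y in cube a ℓ, f y ∂volume ≤ l) :
    (∫⁻ x in cube a ℓ, (l ⊔ (Finset.range K).sup fun k => levelAverage k a ℓ f x) ^ 2) +
        4 * l * ∫⁻ x in cube a ℓ, f x ≤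
      4 * (∫⁻ x in cube a ℓ, f x ^ 2) + 2 * l ^ 2 * volume (cube a ℓ) := by
  induction K generalizing a ℓ l with
  | zero =>
    have h1 : AEMeasurable f (volume.restrict (cube a ℓ)) := hf.restrict
    simp only [Finset.range_zero, Finset.sup_empty, bot_eq_zero', sup_of_le_left zero_le]
    rw [← lintegral_const_mul'' _ h1, ← lintegral_const_mul'' _ (h1.pow_const 2),
      ← lintegral_add_left' aemeasurable_const, ← setLIntegral_const,
      ← lintegral_add_right' _ aemeasurable_const]
    refine lintegral_mono fun x => ?_
    -- The base case is (2f - l)² ≥ 0, written without subtraction.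
    calc l ^ 2 + 4 * l * f x = l ^ 2 + 2 * l * (2 * f x) := by ring
      _ ≤ l ^ 2 + (l ^ 2 + (2 * f x) ^ 2) := by gcongr; exact two_mul_le_sq_add_sq _ _
      _ = 4 * f x ^ 2 + 2 * l ^ 2 := by ring
  | succ K ih =>
    have hV : volume (cube a ℓ) = ∑ e, volume (cube (childCorner a ℓ e) (ℓ / 2)) := by
      simpa using lintegral_cube_eq_sum a hℓ (fun _ => 1)
    rw [lintegral_cube_eq_sum a hℓ, lintegral_cube_eq_sum a hℓ f,
      lintegral_cube_eq_sum a hℓ (fun x => f x ^ 2), hV, Finset.mul_sum, Finset.mul_sum,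
      Finset.mul_sum, ← Finset.sum_add_distrib, ← Finset.sum_add_distrib]
    refine Finset.sum_le_sum fun e _ => ?_
    have hℓ2 : 0 < ℓ / 2 := by positivity
    set b := childCorner a ℓ e with hb
    set A := ⨍⁻ y in cube b (ℓ / 2), f y ∂volume with hA
    have hAf : ∫⁻ x in cube b (ℓ / 2), f x = A * volume (cube b (ℓ / 2)) :=
      (laverage_mul_volume_cube b hℓ2 f).symm
    -- On a child, the generation 0 average of the parent is absorbed by l, and the parent's
    -- generation k + 1 is the child's generation k. So K + 1 levels become K.
    have key : ∀ l', l ≤ l' →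
        ∫⁻ x in cube b (ℓ / 2),
            (l ⊔ (Finset.range (K + 1)).sup fun k => levelAverage k a ℓ f x) ^ 2 ≤
          ∫⁻ x in cube b (ℓ / 2),
            (l' ⊔ (Finset.range K).sup fun k => levelAverage k b (ℓ / 2) f x) ^ 2 := by
      intro l' hl'
      refine setLIntegral_mono' (measurableSet_cube _ _) fun x hx => ?_
      gcongr ?_ ^ 2
      refine sup_le (hl'.trans le_sup_left) (Finset.sup_le fun k hk => ?_)
      rcases k with _ | k
      · exact (levelAverage_zero_le a ℓ f x).trans ((hl.trans hl').trans le_sup_left)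
      · refine (levelAverage_succ_le k a hℓ f e hx).trans (le_trans ?_ le_sup_right)
        exact Finset.le_sup (f := fun k => levelAverage k b (ℓ / 2) f x)
          (by simpa using hk)
    -- If the child's average A stays below l, induction applies with the same l; otherwise l is
    -- raised to A.
    rcases le_or_gt A l with hAl | hAl
    · exact (add_le_add_left (key l le_rfl) _).trans (ih b hℓ2 l hAl)
    have hV0 := volume_cube_ne_top b (ℓ / 2)
    by_cases hF : ∫⁻ x in cube b (ℓ / 2), f x ^ 2 = ∞
    · simp [hF, ENNReal.mul_top]
    have hAtop : A ≠ ∞ := laverage_ne_top_of_sq b hℓ2 hF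
    have h := (add_le_add_left (key A hAl.le) _).trans (ih b hℓ2 A le_rfl)
    set Φ := ∫⁻ x in cube b (ℓ / 2),
            (l ⊔ (Finset.range (K + 1)).sup fun k => levelAverage k a ℓ f x) ^ 2
    set F := ∫⁻ x in cube b (ℓ / 2), f x ^ 2
    set V := volume (cube b (ℓ / 2))
    rw [hAf] at h ⊢
    -- Induction at l = A gives Φ + 4A²V ≤ 4F + 2A²V. The passage back to l then uses 2lA ≤ l² + A².
    have h2 : Φ + 2 * A ^ 2 * V ≤ 4 * F := by
      have h3 : Φ + 2 * A ^ 2 * V + 2 * A ^ 2 * V ≤ 4 * F + 2 * A ^ 2 * V := by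
        refine le_trans (le_of_eq ?_) h
        ring
      exact (ENNReal.add_le_add_iff_right (by finiteness)).1 h3
    calc Φ + 4 * l * (A * V) = Φ + 2 * (2 * l * A) * V := by ring
      _ ≤ Φ + 2 * (l ^ 2 + A ^ 2) * V := by gcongr; exact two_mul_le_sq_add_sq _ _
      _ = (Φ + 2 * A ^ 2 * V) + 2 * l ^ 2 * V := by ring
      _ ≤ _ := by gcongr

theorem measurable_levelAverage (k : ℕ) (a : Fin d → ℝ) (ℓ : ℝ) (v : (Fin d → ℝ) → ℝ≥0∞) :
    Measurable (levelAverage k a ℓ v) :=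
  Measurable.iSup fun _ => measurable_const.indicator (measurableSet_cube _ _)

/-- Doob's inequality in `L²` for the dyadic maximal operator. -/
theorem lintegral_dyadicMax_sq_le {f : (Fin d → ℝ) → ℝ≥0∞} (hf : AEMeasurable f volume)
    (a : Fin d → ℝ) {ℓ : ℝ} (hℓ : 0 < ℓ) :
    ∫⁻ x in cube a ℓ, dyadicMax a ℓ f x ^ 2 ≤ 4 * ∫⁻ x in cube a ℓ, f x ^ 2 := by
  by_cases hF : ∫⁻ x in cube a ℓ, f x ^ 2 = ∞
  · simp [hF, ENNReal.mul_top]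
  set A := ⨍⁻ y in cube a ℓ, f y ∂volume with hA
  have hV0 := volume_cube_ne_top a ℓ
  have hAf : ∫⁻ x in cube a ℓ, f x = A * volume (cube a ℓ) :=
    (laverage_mul_volume_cube a hℓ f).symm
  have hAtop : A ≠ ∞ := laverage_ne_top_of_sq a hℓ hF
  have hK : ∀ K : ℕ,
      ∫⁻ x in cube a ℓ, ((Finset.range K).sup fun k => levelAverage k a ℓ f x) ^ 2 ≤
        4 * ∫⁻ x in cube a ℓ, f x ^ 2 := by
    intro K
    -- Starting at the average itself, the term 4A²V on the left dominates 2A²V on the right.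
    have h := lintegral_sup_levelAverage_sq_add_le hf K a hℓ A le_rfl
    rw [hAf] at h
    set Φ := ∫⁻ x in cube a ℓ, (A ⊔ (Finset.range K).sup fun k => levelAverage k a ℓ f x) ^ 2
    have h1 : Φ ≤ 4 * ∫⁻ x in cube a ℓ, f x ^ 2 := by
      have h0 : 2 * A ^ 2 * volume (cube a ℓ) ≠ ∞ := by finiteness
      refine (ENNReal.add_le_add_iff_right h0).1 (le_trans ?_ h)
      calc Φ + 2 * A ^ 2 * volume (cube a ℓ) ≤ Φ + 4 * A ^ 2 * volume (cube a ℓ) := by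
            gcongr; norm_num
        _ = _ := by ring
    refine le_trans (lintegral_mono fun x => ?_) h1
    gcongr ?_ ^ 2
    exact le_sup_right
  -- Squaring is an order isomorphism of [0, ∞], so it commutes with the supremum; monotone
  -- convergence then passes from finitely many generations to all.
  have hsup : ∀ x, dyadicMax a ℓ f x ^ 2 =
      ⨆ K : ℕ, ((Finset.range K).sup fun k => levelAverage k a ℓ f x) ^ 2 := by
    intro x
    have h1 : dyadicMax a ℓ f x =
        ⨆ K : ℕ, (Finset.range K).sup fun k => levelAverage k a ℓ f x := by
      refine le_antisymm (iSup_le fun k => ?_) (iSup_le fun K => Finset.sup_le fun k _ => ?_)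
      · refine le_iSup_of_le (k + 1) ?_
        exact Finset.le_sup (f := fun k => levelAverage k a ℓ f x) (by simp)
      · exact le_iSup (fun k => levelAverage k a ℓ f x) k
    have h2 := (ENNReal.orderIsoRpow 2 two_pos).map_iSup
      fun K : ℕ => (Finset.range K).sup fun k => levelAverage k a ℓ f x
    simp only [ENNReal.orderIsoRpow_apply, ENNReal.rpow_two] at h2
    rw [h1, h2]
  simp_rw [hsup]
  rw [lintegral_iSup]
  · exact iSup_le hK
  · intro K
    refine Measurable.pow_const ?_ 2
    induction K with
    | zero => simp
    | succ K ih =>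
      simp only [Finset.range_add_one, Finset.sup_insert]
      exact (measurable_levelAverage K a ℓ f).sup ih
  · intro K K' h x
    dsimp only
    gcongr

end DyadicMax

/-! ### Scalar characteristics -/

section Scalar

variable {d : ℕ} {w : (Fin d → ℝ) → ℝ≥0∞} {α β ρ : ℝ} {K : ℝ≥0∞}

/-- Passing from w to w ^ ρ multiplies reciprocal exponents by ρ and raises norms to the power ρ; (α
+ β)ρ = 1 makes the new exponents conjugate. -/
theorem scalarChar_rpow_le (hα : 0 ≤ α) (hβ : 0 ≤ β) (hρ : 0 < ρ) (h : (α + β) * ρ = 1)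
    (hK : ∀ a ℓ, 0 < ℓ → eLpNorm w (expOf α) (avgMeasure a ℓ) *
      eLpNorm (fun x => (w x)⁻¹) (expOf β) (avgMeasure a ℓ) ≤ K) :
    scalarChar (fun x => w x ^ ρ) (expOf (α * ρ)) ^ ρ⁻¹ ≤ K := by
  rw [ENNReal.rpow_inv_le_iff hρ]
  refine iSup_le fun a => iSup_le fun ℓ => iSup_le fun hℓ => ?_
  have hβρ := mul_nonneg hβ hρ.le
  rw [conjExponent_expOf (mul_nonneg hα hρ.le) (by linarith),
    show 1 - α * ρ = β * ρ by linarith]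
  simp_rw [← ENNReal.inv_rpow]
  rw [eLpNorm_rpow hρ, eLpNorm_rpow hρ, ← ENNReal.mul_rpow_of_nonneg _ _ hρ.le]
  exact ENNReal.rpow_le_rpow (hK a ℓ hℓ) hρ.le

/-- A reverse Hölder inequality: on a probability space 1 = ‖w · w⁻¹‖ ≤ ‖w‖_{1/(2α)} ‖w⁻¹‖_{1/β},
and multiplying by ‖w‖_{1/α} brings in K. -/
theorem lintegral_avgMeasure_rpow_le (hw : AEMeasurable w volume)
    (hw' : ∀ᵐ x ∂volume, w x ≠ 0 ∧ w x ≠ ∞) (hα : 0 < α) (hβ : 0 ≤ β) (a : Fin d → ℝ) {ℓ : ℝ}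
    (hℓ : 0 < ℓ)
    (hK : eLpNorm w (expOf α) (avgMeasure a ℓ) *
      eLpNorm (fun x => (w x)⁻¹) (expOf β) (avgMeasure a ℓ) ≤ K) :
    ∫⁻ x, w x ^ α⁻¹ ∂avgMeasure a ℓ ≤
      K ^ α⁻¹ * (∫⁻ x, w x ^ (2 * α)⁻¹ ∂avgMeasure a ℓ) ^ 2 := by
  have := isProbabilityMeasure_avgMeasure a hℓ
  have hac := avgMeasure_absolutelyContinuous a ℓ
  have hw1 : AEMeasurable w (avgMeasure a ℓ) := hw.mono_ac hac
  have h2α : 0 < 2 * α := by positivity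
  set X := eLpNorm w (expOf α) (avgMeasure a ℓ) with hX
  set Y := eLpNorm (fun x => (w x)⁻¹) (expOf β) (avgMeasure a ℓ)
  set Z := eLpNorm w (expOf (2 * α)) (avgMeasure a ℓ) with hZ
  have h1 : 1 ≤ Z * Y := by
    refine le_trans (le_of_eq ?_) (eLpNorm_mul_le h2α.le hβ hw1 hw1.inv)
    have : eLpNorm (fun x => w x * (w x)⁻¹) (expOf (2 * α + β)) (avgMeasure a ℓ) =
        eLpNorm (fun _ => (1 : ℝ≥0∞)) (expOf (2 * α + β)) (avgMeasure a ℓ) := by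
      refine eLpNorm_congr_ae ?_
      filter_upwards [hac.ae_le hw'] with x hx
      exact ENNReal.mul_inv_cancel hx.1 hx.2
    rw [this, eLpNorm_const _ (expOf_ne_zero _) (IsProbabilityMeasure.ne_zero _)]
    simp
  have h2 : X ≤ K * Z := by
    calc X ≤ X * (Z * Y) := le_mul_of_one_le_right zero_le h1
      _ = X * Y * Z := by ring
      _ ≤ K * Z := by gcongr
  have h3 := ENNReal.rpow_le_rpow h2 (inv_nonneg.2 hα.le)
  rw [ENNReal.mul_rpow_of_nonneg _ _ (inv_nonneg.2 hα.le), hX, hZ, eLpNorm_expOf_of_pos hα,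
    eLpNorm_expOf_of_pos h2α, ← ENNReal.rpow_mul, ← ENNReal.rpow_mul, mul_inv_cancel₀ hα.ne',
    ENNReal.rpow_one, show 2 * α * α⁻¹ = 2 by field_simp, ENNReal.rpow_two] at h3
  exact h3

/-- Reverse Hölder on every dyadic subcube bounds the maximal function by K^{1/α} times the square
of the maximal function of the square root. Doob's constant 4 becomes 4 ^ α after taking roots. -/
theorem fujiiWilson_rpow_le (hw : AEMeasurable w volume)
    (hw' : ∀ᵐ x ∂volume, w x ≠ 0 ∧ w x ≠ ∞) (hα : 0 < α) (hβ : 0 ≤ β)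
    (hK : ∀ a ℓ, 0 < ℓ → eLpNorm w (expOf α) (avgMeasure a ℓ) *
      eLpNorm (fun x => (w x)⁻¹) (expOf β) (avgMeasure a ℓ) ≤ K) :
    fujiiWilson (fun x => w x ^ α⁻¹) ^ α ≤ 4 ^ α * K := by
  have h : 4 ^ α * K = (4 * K ^ α⁻¹) ^ α := by
    rw [ENNReal.mul_rpow_of_nonneg _ _ hα.le, ← ENNReal.rpow_mul, inv_mul_cancel₀ hα.ne',
      ENNReal.rpow_one]
  rw [h]
  refine ENNReal.rpow_le_rpow ?_ hα.le
  refine iSup_le fun a => iSup_le fun ℓ => iSup_le fun hℓ => ENNReal.div_le_of_le_mul ?_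
  have hsq : ∀ x, (w x ^ (2 * α)⁻¹) ^ 2 = w x ^ α⁻¹ := fun x => by
    rw [← ENNReal.rpow_two, ← ENNReal.rpow_mul]
    congr 1
    field_simp
  have hmeas : Measurable (dyadicMax a ℓ fun x => w x ^ (2 * α)⁻¹) := by
    have : dyadicMax a ℓ (fun x => w x ^ (2 * α)⁻¹) =
        fun x => ⨆ k, levelAverage k a ℓ (fun x => w x ^ (2 * α)⁻¹) x := rfl
    rw [this]
    exact Measurable.iSup fun k => measurable_levelAverage k a ℓ _
  calc ∫⁻ x in cube a ℓ, dyadicMax a ℓ (fun x => w x ^ α⁻¹) x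
      ≤ ∫⁻ x in cube a ℓ, K ^ α⁻¹ * dyadicMax a ℓ (fun x => w x ^ (2 * α)⁻¹) x ^ 2 := by
        refine lintegral_mono fun x => iSup_le fun k => iSup_le fun i => ?_
        refine Set.indicator_apply_le' (fun hx => ?_) (fun _ => by simp)
        have hk : 0 < ℓ / 2 ^ k := by positivity
        rw [setLAverage_eq_lintegral_avgMeasure]
        refine (lintegral_avgMeasure_rpow_le hw hw' hα hβ _ hk (hK _ _ hk)).trans ?_
        gcongr
        refine le_trans ?_ (le_iSup_of_le k (le_iSup _ i))
        rw [Set.indicator_of_mem hx, setLAverage_eq_lintegral_avgMeasure]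
    _ = K ^ α⁻¹ * ∫⁻ x in cube a ℓ, dyadicMax a ℓ (fun x => w x ^ (2 * α)⁻¹) x ^ 2 :=
        lintegral_const_mul _ (hmeas.pow_const 2)
    _ ≤ K ^ α⁻¹ * (4 * ∫⁻ x in cube a ℓ, (w x ^ (2 * α)⁻¹) ^ 2) := by
        gcongr
        exact lintegral_dyadicMax_sq_le (hw.pow_const _) a hℓ
    _ = _ := by
        simp_rw [hsq]
        ring

end Scalar

/-! ### Norms of matrices and of tensor products -/

section MatrixNorms

variable {𝕜 : Type*} [RCLike 𝕜] {ι : Type*} [Fintype ι] [DecidableEq ι]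

theorem normMul_mul_le (A B : Matrix ι ι 𝕜) (v : EuclideanSpace 𝕜 ι) :
    normMul (A * B) v ≤ opNorm A * normMul B v := by
  have h : normMul (A * B) v = ‖Matrix.toEuclideanCLM (n := ι) (𝕜 := 𝕜) A
      (Matrix.toEuclideanCLM (n := ι) (𝕜 := 𝕜) B v)‖ₑ := by
    rw [normMul, map_mul]
    rfl
  rw [h, normMul, opNorm]
  generalize Matrix.toEuclideanCLM (n := ι) (𝕜 := 𝕜) B v = u
  generalize Matrix.toEuclideanCLM (n := ι) (𝕜 := 𝕜) A = T
  exact T.le_opENorm u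

theorem normMul_one (v : EuclideanSpace 𝕜 ι) : normMul (1 : Matrix ι ι 𝕜) v = ‖v‖ₑ := by
  rw [normMul, map_one]
  rfl

theorem normMul_le (A : Matrix ι ι 𝕜) (v : EuclideanSpace 𝕜 ι) :
    normMul A v ≤ opNorm A * ‖v‖ₑ := by
  simpa [normMul_one] using normMul_mul_le A 1 v

theorem normMul_ne_top (A : Matrix ι ι 𝕜) (v : EuclideanSpace 𝕜 ι) : normMul A v ≠ ∞ :=
  enorm_ne_top

theorem opNorm_mul_le (A B : Matrix ι ι 𝕜) : opNorm (A * B) ≤ opNorm A * opNorm B := by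
  rw [opNorm, opNorm, opNorm, map_mul, ← ofReal_norm, ← ofReal_norm, ← ofReal_norm,
    ← ENNReal.ofReal_mul (norm_nonneg _)]
  exact ENNReal.ofReal_le_ofReal (norm_mul_le _ _)

theorem opNorm_one_le : opNorm (1 : Matrix ι ι 𝕜) ≤ 1 := by
  rw [opNorm, map_one, ← ofReal_norm]
  exact ENNReal.ofReal_le_one.2 ContinuousLinearMap.norm_id_le

theorem opNorm_conjTranspose (A : Matrix ι ι 𝕜) : opNorm A.conjTranspose = opNorm A := by
  rw [opNorm, opNorm, ← Matrix.star_eq_conjTranspose, map_star,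
    ContinuousLinearMap.star_eq_adjoint, ← ofReal_norm, LinearIsometryEquiv.norm_map, ofReal_norm]

theorem normMul_ne_zero {A B : Matrix ι ι 𝕜} (h : B * A = 1) {v : EuclideanSpace 𝕜 ι}
    (hv : v ≠ 0) : normMul A v ≠ 0 := by
  intro h0
  have h1 := normMul_mul_le B A v
  rw [h, h0, mul_zero, normMul, map_one] at h1
  simp [hv] at h1

theorem _root_.Matrix.PosDef.inv_mul_self {A : Matrix ι ι 𝕜} (hA : A.PosDef) : A⁻¹ * A = 1 :=
  Matrix.nonsing_inv_mul A ((Matrix.isUnit_iff_isUnit_det A).1 hA.isUnit)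

theorem _root_.Matrix.PosDef.mul_inv_self {A : Matrix ι ι 𝕜} (hA : A.PosDef) : A * A⁻¹ = 1 :=
  Matrix.mul_nonsing_inv A ((Matrix.isUnit_iff_isUnit_det A).1 hA.isUnit)

theorem opNorm_inv_mul {A B : Matrix ι ι 𝕜} (hA : A.PosDef) (hB : B.PosDef) :
    opNorm (B⁻¹ * A) = opNorm (A * B⁻¹) := by
  rw [← opNorm_conjTranspose, Matrix.conjTranspose_mul, hA.isHermitian.eq,
    hB.isHermitian.inv.eq]

/-- Write B⁻¹ = (B⁻¹A)A⁻¹; the adjoint turns the norm of B⁻¹A into that of AB⁻¹. -/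
theorem normMul_inv_le {A B : Matrix ι ι 𝕜} (hA : A.PosDef) (hB : B.PosDef)
    (v : EuclideanSpace 𝕜 ι) :
    normMul B⁻¹ v ≤ opNorm (A * B⁻¹) * normMul A⁻¹ v := by
  rw [← opNorm_inv_mul hA hB]
  refine le_trans (le_of_eq ?_) (normMul_mul_le _ _ _)
  rw [mul_assoc, hA.mul_inv_self, mul_one]

end MatrixNorms

section Tensor

variable {𝕜 : Type*} [RCLike 𝕜] {m : ℕ} {n : Fin m → ℕ}

theorem tensorMatrix_mul (A B : ∀ j, Matrix (Fin (n j)) (Fin (n j)) 𝕜) :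
    tensorMatrix A * tensorMatrix B = tensorMatrix fun j => A j * B j := by
  ext a b
  simp only [tensorMatrix, Matrix.mul_apply, Matrix.of_apply, ← Finset.prod_mul_distrib]
  rw [Finset.prod_univ_sum]
  simp [Fintype.piFinset_univ]

theorem tensorMatrix_one :
    tensorMatrix (fun j => (1 : Matrix (Fin (n j)) (Fin (n j)) 𝕜)) = 1 := by
  ext a b
  simp only [tensorMatrix, Matrix.of_apply, Matrix.one_apply]
  rw [Finset.prod_ite_zero]
  simp [funext_iff]

theorem enorm_tensorVec (u : ∀ j, EuclideanSpace 𝕜 (Fin (n j))) :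
    ‖tensorVec u‖ₑ = ∏ j, ‖u j‖ₑ := by
  have h : ‖tensorVec u‖ ^ 2 = (∏ j, ‖u j‖) ^ 2 := by
    have := inner_tensorVec (𝕜 := 𝕜) u u
    simp only [inner_self_eq_norm_sq_to_K] at this
    rw [← Finset.prod_pow]
    exact_mod_cast this
  have h2 : ‖tensorVec u‖ = ∏ j, ‖u j‖ :=
    (pow_left_inj₀ (norm_nonneg _) (Finset.prod_nonneg fun _ _ => norm_nonneg _) two_ne_zero).1 h
  rw [← ofReal_norm, h2, ENNReal.ofReal_prod_of_nonneg fun _ _ => norm_nonneg _]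
  simp

theorem normMul_tensorMatrix_tensorVec (A : ∀ j, Matrix (Fin (n j)) (Fin (n j)) 𝕜)
    (u : ∀ j, EuclideanSpace 𝕜 (Fin (n j))) :
    normMul (tensorMatrix A) (tensorVec u) = ∏ j, normMul (A j) (u j) := by
  rw [normMul, tensorMatrix_tensorVec, enorm_tensorVec]
  rfl

theorem tensorMatrix_update_apply (j : Fin m) (A : Matrix (Fin (n j)) (Fin (n j)) 𝕜)
    (v : EuclideanSpace 𝕜 (∀ j, Fin (n j))) (a : ∀ j, Fin (n j)) :
    Matrix.toEuclideanCLM (n := ∀ j, Fin (n j)) (𝕜 := 𝕜)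
        (tensorMatrix (Function.update (fun i => (1 : Matrix (Fin (n i)) (Fin (n i)) 𝕜)) j A)) v a =
      ∑ c, A (a j) c * v (Function.update a j c) := by
  rw [Matrix.ofLp_toEuclideanCLM]
  simp only [Matrix.mulVec, dotProduct, tensorMatrix, Matrix.of_apply]
  symm
  refine Fintype.sum_of_injective (fun c => Function.update a j c)
    (Function.update_injective a j) _ _ (fun b hb => ?_) (fun c => ?_)
  -- An index outside the fibre differs from `a` in a slot other than j, where the identity matrix
  -- contributes a zero factor.
  · obtain ⟨i, hij, hi⟩ : ∃ i, i ≠ j ∧ a i ≠ b i := by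
      by_contra! h
      refine hb ⟨b j, ?_⟩
      funext i
      by_cases hij : i = j
      · subst hij; simp
      · simp [hij, h i hij]
    rw [Finset.prod_eq_zero (Finset.mem_univ i), zero_mul]
    simp [hij, hi]
  · rw [Finset.prod_eq_single j]
    · simp
    · intro i _ hij
      simp [hij]
    · simp

/-- Freezing all coordinates but the j-th cuts v into slices. The operator acts as A on each slice,
and squared norms add over the slices. -/
theorem opNorm_tensorMatrix_update_le (j : Fin m) (A : Matrix (Fin (n j)) (Fin (n j)) 𝕜) :
    opNorm (tensorMatrix
      (Function.update (fun i => (1 : Matrix (Fin (n i)) (Fin (n i)) 𝕜)) j A)) ≤ opNorm A := by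
  rw [opNorm, opNorm, enorm_le_iff_norm_le]
  refine ContinuousLinearMap.opNorm_le_bound _ (norm_nonneg _) fun v => ?_
  refine (pow_le_pow_iff_left₀ (norm_nonneg _) (by positivity) two_ne_zero).1 ?_
  rw [mul_pow, EuclideanSpace.norm_sq_eq, EuclideanSpace.norm_sq_eq]
  let σ := Equiv.piSplitAt j fun i => Fin (n i)
  have hσj : ∀ c r, σ.symm (c, r) j = c := fun c r => by simp [σ]
  have hσ : ∀ c c' r, Function.update (σ.symm (c, r)) j c' = σ.symm (c', r) := by
    intro c c' r
    funext i
    by_cases hi : i = j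
    · subst hi; simp [σ]
    · simp [σ, hi]
  rw [← σ.symm.sum_comp, ← σ.symm.sum_comp, Fintype.sum_prod_type_right,
    Fintype.sum_prod_type_right, Finset.mul_sum]
  refine Finset.sum_le_sum fun r _ => ?_
  let u : EuclideanSpace 𝕜 (Fin (n j)) := WithLp.toLp 2 fun c => v (σ.symm (c, r))
  have h1 : ∑ c, ‖v (σ.symm (c, r))‖ ^ 2 = ‖u‖ ^ 2 := by
    rw [EuclideanSpace.norm_sq_eq]
  have h2 : ∑ c, ‖Matrix.toEuclideanCLM (n := ∀ j, Fin (n j)) (𝕜 := 𝕜) (tensorMatrix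
      (Function.update (fun i => (1 : Matrix (Fin (n i)) (Fin (n i)) 𝕜)) j A)) v
        (σ.symm (c, r))‖ ^ 2 =
      ‖Matrix.toEuclideanCLM (n := Fin (n j)) (𝕜 := 𝕜) A u‖ ^ 2 := by
    rw [EuclideanSpace.norm_sq_eq]
    refine Finset.sum_congr rfl fun c _ => ?_
    rw [tensorMatrix_update_apply, Matrix.ofLp_toEuclideanCLM]
    simp only [hσ, hσj]
    rfl
  rw [h1, h2, ← mul_pow]
  gcongr
  exact ContinuousLinearMap.le_opNorm _ _

/-- The tensor product is a product of operators acting in one slot each. -/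
theorem opNorm_tensorMatrix_le (A : ∀ j, Matrix (Fin (n j)) (Fin (n j)) 𝕜) :
    opNorm (tensorMatrix A) ≤ ∏ j, opNorm (A j) := by
  have h : ∀ s : Finset (Fin m),
      opNorm (tensorMatrix fun j => if j ∈ s then A j else 1) ≤ ∏ j ∈ s, opNorm (A j) := by
    intro s
    induction s using Finset.induction_on with
    | empty => simpa [tensorMatrix_one] using opNorm_one_le
    | insert i s hi ih =>
      have : (fun j => if j ∈ insert i s then A j else 1) = fun j =>
          (Function.update (fun i => (1 : Matrix (Fin (n i)) (Fin (n i)) 𝕜)) i (A i)) j *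
            (if j ∈ s then A j else 1) := by
        funext j
        by_cases hj : j = i
        · subst hj; simp [hi]
        · simp [hj]
      rw [this, ← tensorMatrix_mul, Finset.prod_insert hi]
      exact (opNorm_mul_le _ _).trans (mul_le_mul' (opNorm_tensorMatrix_update_le _ _) ih)
  simpa using h Finset.univ

theorem normMul_tensorMatrix_le {A B : ∀ j, Matrix (Fin (n j)) (Fin (n j)) 𝕜}
    (hB : ∀ j, (B j).PosDef) (v : EuclideanSpace 𝕜 (∀ j, Fin (n j))) :
    normMul (tensorMatrix A) v ≤
      (∏ j, opNorm (A j * (B j)⁻¹)) * normMul (tensorMatrix B) v := by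
  have h : A = fun j => A j * (B j)⁻¹ * B j := by
    funext j
    rw [mul_assoc, (hB j).inv_mul_self, mul_one]
  conv_lhs => rw [h, ← tensorMatrix_mul]
  exact (normMul_mul_le _ _ _).trans (mul_le_mul' (opNorm_tensorMatrix_le _) le_rfl)

theorem tensorMatrix_inv_mul {A : ∀ j, Matrix (Fin (n j)) (Fin (n j)) 𝕜}
    (hA : ∀ j, (A j).PosDef) : tensorMatrix (fun j => (A j)⁻¹) * tensorMatrix A = 1 := by
  simp_rw [tensorMatrix_mul, fun j => (hA j).inv_mul_self, tensorMatrix_one]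

end Tensor

/-! ### Measurability of matrix weights -/

section Measurability

variable {𝕜 : Type*} [RCLike 𝕜] {ι : Type*} [Fintype ι] [DecidableEq ι] {d : ℕ}
  {W : (Fin d → ℝ) → Matrix ι ι 𝕜}

theorem IsMatrixWeight.aestronglyMeasurable (hW : IsMatrixWeight W) :
    AEStronglyMeasurable W volume := by
  have : W = fun x => ∑ i, ∑ j, W x i j • Matrix.single i j (1 : 𝕜) := by
    funext x
    conv_lhs => rw [Matrix.matrix_eq_sum_single (W x)]
    simp
  rw [this]
  exact Finset.aestronglyMeasurable_fun_sum _ fun i _ => Finset.aestronglyMeasurable_fun_sum _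
    fun j _ => (hW.1 i j).smul_const _

theorem IsMatrixWeight.inv_aestronglyMeasurable (hW : IsMatrixWeight W) :
    AEStronglyMeasurable (fun x => (W x)⁻¹) volume := by
  simp_rw [Matrix.inv_def, Ring.inverse_eq_inv']
  have h1 := (continuous_id (X := Matrix ι ι 𝕜)).matrix_det.comp_aestronglyMeasurable
    hW.aestronglyMeasurable
  have h2 := (continuous_id (X := Matrix ι ι 𝕜)).matrix_adjugate.comp_aestronglyMeasurable
    hW.aestronglyMeasurable
  exact h1.inv₀.smul h2

theorem continuous_toEuclideanCLM :
    Continuous fun A : Matrix ι ι 𝕜 => Matrix.toEuclideanCLM (n := ι) (𝕜 := 𝕜) A :=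
  LinearMap.continuous_of_finiteDimensional
    (Matrix.toEuclideanCLM (n := ι) (𝕜 := 𝕜)).toAlgEquiv.toLinearMap

theorem aemeasurable_opNorm {α : Type*} [MeasurableSpace α] {μ : Measure α}
    {A : α → Matrix ι ι 𝕜} (hA : AEStronglyMeasurable A μ) :
    AEMeasurable (fun x => opNorm (A x)) μ :=
  (continuous_toEuclideanCLM.comp_aestronglyMeasurable hA).enorm

theorem aestronglyMeasurable_toEuclideanCLM_apply {α : Type*} [MeasurableSpace α] {μ : Measure α}
    {A : α → Matrix ι ι 𝕜} (hA : AEStronglyMeasurable A μ) (v : EuclideanSpace 𝕜 ι) :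
    AEStronglyMeasurable (fun x => Matrix.toEuclideanCLM (n := ι) (𝕜 := 𝕜) (A x) v) μ :=
  (continuous_toEuclideanCLM.comp_aestronglyMeasurable hA).apply_continuousLinearMap v

theorem aemeasurable_normMul {α : Type*} [MeasurableSpace α] {μ : Measure α}
    {A : α → Matrix ι ι 𝕜} (hA : AEStronglyMeasurable A μ) (v : EuclideanSpace 𝕜 ι) :
    AEMeasurable (fun x => normMul (A x) v) μ :=
  (aestronglyMeasurable_toEuclideanCLM_apply hA v).enorm

theorem aestronglyMeasurable_tensorMatrix {m : ℕ} {n : Fin m → ℕ}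
    {W : ∀ j, (Fin d → ℝ) → Matrix (Fin (n j)) (Fin (n j)) 𝕜}
    (hW : ∀ j, IsMatrixWeight (W j)) :
    AEStronglyMeasurable (fun x => tensorMatrix fun j => W j x) volume := by
  have : (fun x => tensorMatrix fun j => W j x) = fun x => ∑ a, ∑ b,
      (∏ j, W j x (a j) (b j)) • Matrix.single a b (1 : 𝕜) := by
    funext x
    conv_lhs => rw [Matrix.matrix_eq_sum_single (tensorMatrix fun j => W j x)]
    simp [tensorMatrix]
  rw [this]
  exact Finset.aestronglyMeasurable_fun_sum _ fun a _ => Finset.aestronglyMeasurable_fun_sum _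
    fun b _ => (Finset.aestronglyMeasurable_fun_prod _ fun j _ => (hW j).1 _ _).smul_const _

end Measurability

/-! ### Directional bounds for the operator characteristic -/

section Directional

variable {𝕜 : Type*} [RCLike 𝕜] {d m : ℕ} {n : Fin m → ℕ}
  {W : ∀ j, (Fin d → ℝ) → Matrix (Fin (n j)) (Fin (n j)) 𝕜} {τ : Fin m → ℝ} {b : ℝ}

theorem le_opChar (W : ∀ j, (Fin d → ℝ) → Matrix (Fin (n j)) (Fin (n j)) 𝕜) (t : Fin m → ℝ≥0∞)
    (q : ℝ≥0∞) (a : Fin d → ℝ) {ℓ : ℝ} (hℓ : 0 < ℓ) :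
    eLpNorm (fun x => ∏ j, eLpNorm (fun y => opNorm (W j x * (W j y)⁻¹)) (t j) (avgMeasure a ℓ))
      q (avgMeasure a ℓ) ≤ opChar W t q :=
  le_iSup_of_le a (le_iSup_of_le ℓ (le_iSup_of_le hℓ le_rfl))

theorem ae_posDef (hW : ∀ j, IsMatrixWeight (W j)) {μ : Measure (Fin d → ℝ)} (hμ : μ ≪ volume) :
    ∀ᵐ x ∂μ, ∀ j, (W j x).PosDef :=
  hμ.ae_le (ae_all_iff.2 fun j => (hW j).2)

theorem aemeasurable_opNorm_mul_inv {j : Fin m} (hW : IsMatrixWeight (W j))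
    {μ : Measure (Fin d → ℝ)} (hμ : μ ≪ volume) (A : Matrix (Fin (n j)) (Fin (n j)) 𝕜) :
    AEMeasurable (fun y => opNorm (A * (W j y)⁻¹)) μ :=
  aemeasurable_opNorm ((continuous_const.matrix_mul continuous_id).comp_aestronglyMeasurable
    (hW.inv_aestronglyMeasurable.mono_ac hμ))

theorem eLpNorm_tensor_mul_eLpNorm_inv_le (hW : ∀ j, IsMatrixWeight (W j)) (hb : 0 ≤ b)
    (hτ : ∀ j, 0 ≤ τ j) (v : EuclideanSpace 𝕜 (∀ j, Fin (n j))) (a : Fin d → ℝ)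
    {ℓ : ℝ} (hℓ : 0 < ℓ) :
    eLpNorm (fun x => normMul (tensorMatrix fun j => W j x) v) (expOf b) (avgMeasure a ℓ) *
        eLpNorm (fun x => (normMul (tensorMatrix fun j => W j x) v)⁻¹) (expOf (∑ j, τ j))
          (avgMeasure a ℓ) ≤
      opChar W (fun j => expOf (τ j)) (expOf b) := by
  have hac := avgMeasure_absolutelyContinuous a ℓ
  have hmeas : AEMeasurable (fun x => normMul (tensorMatrix fun j => W j x) v) (avgMeasure a ℓ) :=
    aemeasurable_normMul ((aestronglyMeasurable_tensorMatrix hW).mono_ac hac) v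
  have hinv : AEMeasurable (fun x => (normMul (tensorMatrix fun j => W j x) v)⁻¹)
      (avgMeasure a ℓ) := hmeas.inv
  refine le_trans ?_ (le_opChar W _ _ a hℓ)
  -- The inverse factor is a constant and moves into the norm in x; at fixed x, the value at x then
  -- moves into the norm in y.
  rw [mul_comm, ← eLpNorm_const_mul hb _ hmeas]
  refine eLpNorm_mono_enorm_ae ?_
  filter_upwards [ae_posDef hW hac] with x hx
  simp only [enorm_eq_self]
  rw [mul_comm, ← eLpNorm_const_mul (Finset.sum_nonneg fun j _ => hτ j) _ hinv]
  refine le_trans (eLpNorm_mono_enorm_ae ?_) (eLpNorm_prod_le Finset.univ hτ fun j =>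
    aemeasurable_opNorm_mul_inv (hW j) hac (W j x))
  filter_upwards [ae_posDef hW hac] with y hy
  simp only [enorm_eq_self]
  exact ENNReal.div_le_of_le_mul (normMul_tensorMatrix_le hy v)

theorem eLpNorm_inv_mul_eLpNorm_inv_le (hn : ∀ j, 0 < n j) (hW : ∀ j, IsMatrixWeight (W j))
    (hb : 0 ≤ b) (hτ : ∀ j, 0 ≤ τ j) (j : Fin m) {v : EuclideanSpace 𝕜 (Fin (n j))} (hv : v ≠ 0)
    (a : Fin d → ℝ) {ℓ : ℝ} (hℓ : 0 < ℓ) :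
    eLpNorm (fun x => normMul (W j x)⁻¹ v) (expOf (τ j)) (avgMeasure a ℓ) *
        eLpNorm (fun x => (normMul (W j x)⁻¹ v)⁻¹) (expOf (b + ∑ i ∈ Finset.univ.erase j, τ i))
          (avgMeasure a ℓ) ≤
      opChar W (fun j => expOf (τ j)) (expOf b) := by
  classical
  have hac := avgMeasure_absolutelyContinuous a ℓ
  -- Any nonzero vectors serve in the other slots; their contributions cancel in the end.
  have hv' : ∀ i, ∃ u : EuclideanSpace 𝕜 (Fin (n i)), u ≠ 0 := fun i =>
    have : Nonempty (Fin (n i)) := ⟨⟨0, hn i⟩⟩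
    exists_ne 0
  choose u' hu' using hv'
  set u := Function.update u' j v with hu
  have huj : u j = v := by simp [hu]
  have hu0 : ∀ i, u i ≠ 0 := fun i => by
    by_cases hi : i = j
    · subst hi; rwa [huj]
    · simpa [hu, hi] using hu' i
  set h : ∀ i, (Fin d → ℝ) → ℝ≥0∞ := fun i x => normMul (W i x)⁻¹ (u i) with hh
  have hmeas : ∀ i, AEMeasurable (h i) (avgMeasure a ℓ) := fun i =>
    aemeasurable_normMul ((hW i).inv_aestronglyMeasurable.mono_ac hac) (u i)
  have hinv : AEMeasurable (fun x => ∏ i, (h i x)⁻¹) (avgMeasure a ℓ) :=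
    Finset.aemeasurable_fun_prod _ fun i _ => (hmeas i).inv
  set N : Fin m → ℝ≥0∞ := fun i => eLpNorm (h i) (expOf (τ i)) (avgMeasure a ℓ) with hN
  have h1 : (∏ i, N i) * eLpNorm (fun x => ∏ i, (h i x)⁻¹) (expOf b) (avgMeasure a ℓ) ≤
      opChar W (fun j => expOf (τ j)) (expOf b) := by
    refine le_trans ?_ (le_opChar W _ _ a hℓ)
    rw [← eLpNorm_const_mul hb _ hinv]
    refine eLpNorm_mono_enorm_ae ?_
    filter_upwards [ae_posDef hW hac] with x hx
    simp only [enorm_eq_self]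
    rw [← Finset.prod_mul_distrib]
    refine Finset.prod_le_prod' fun i _ => ?_
    rw [mul_comm, hN, ← eLpNorm_const_mul (hτ i) _ (hmeas i)]
    refine eLpNorm_mono_enorm_ae ?_
    filter_upwards [ae_posDef hW hac] with y hy
    simp only [enorm_eq_self]
    rw [mul_comm]
    exact ENNReal.div_le_of_le_mul (normMul_inv_le (hx i) (hy i) (u i))
  -- Hölder for h_j⁻¹ = ∏ h_i⁻¹ · ∏_{i≠j} h_i; the cancellation uses that each h_i is almost
  -- everywhere nonzero and finite.
  have h2 : eLpNorm (fun x => (h j x)⁻¹) (expOf (b + ∑ i ∈ Finset.univ.erase j, τ i))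
      (avgMeasure a ℓ) ≤ eLpNorm (fun x => ∏ i, (h i x)⁻¹) (expOf b) (avgMeasure a ℓ) *
        ∏ i ∈ Finset.univ.erase j, N i := by
    refine le_trans (eLpNorm_mono_enorm_ae ?_) ((eLpNorm_mul_le hb
      (Finset.sum_nonneg fun i _ => hτ i) hinv (Finset.aemeasurable_fun_prod
        (Finset.univ.erase j) fun i _ => hmeas i)).trans
      (mul_le_mul' le_rfl (eLpNorm_prod_le _ hτ hmeas)))
    filter_upwards [ae_posDef hW hac] with x hx
    simp only [enorm_eq_self]
    rw [← Finset.mul_prod_erase _ _ (Finset.mem_univ j), mul_assoc, ← Finset.prod_mul_distrib,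
      Finset.prod_eq_one, mul_one]
    exact fun i _ => ENNReal.inv_mul_cancel (normMul_ne_zero (hx i).mul_inv_self (hu0 i))
      (normMul_ne_top _ _)
  have h3 : (fun x => normMul (W j x)⁻¹ v) = h j := by
    funext x
    simp only [hh, huj]
  simp only [show ∀ x, normMul (W j x)⁻¹ v = h j x from congrFun h3]
  calc N j * eLpNorm (fun x => (h j x)⁻¹) (expOf (b + ∑ i ∈ Finset.univ.erase j, τ i))
        (avgMeasure a ℓ)
      ≤ N j * (eLpNorm (fun x => ∏ i, (h i x)⁻¹) (expOf b) (avgMeasure a ℓ) *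
        ∏ i ∈ Finset.univ.erase j, N i) := mul_le_mul' le_rfl h2
    _ = (∏ i, N i) * eLpNorm (fun x => ∏ i, (h i x)⁻¹) (expOf b) (avgMeasure a ℓ) := by
      rw [← Finset.mul_prod_erase _ N (Finset.mem_univ j)]
      ring
    _ ≤ _ := h1

/-- The bounds in all directions, in terms of the reciprocals `b = 1/q` and `τ_j = 1/t_j`. -/
theorem directional_bounds (hn : ∀ j, 0 < n j) (hW : ∀ j, IsMatrixWeight (W j)) (hb : 0 ≤ b)
    (hτ : ∀ j, 0 ≤ τ j) (hpos : 0 < b + ∑ j, τ j) :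
    directionalChar (fun x => tensorMatrix fun j => W j x) (b + ∑ j, τ j)⁻¹
        (expOf (b / (b + ∑ j, τ j))) ≤ opChar W (fun j => expOf (τ j)) (expOf b) ∧
      (∀ j, directionalChar (fun x => (W j x)⁻¹) (b + ∑ j, τ j)⁻¹
        (expOf (τ j / (b + ∑ j, τ j))) ≤ opChar W (fun j => expOf (τ j)) (expOf b)) ∧
      (0 < b → matrixFW (fun x => tensorMatrix fun j => W j x) (expOf b) ≤
        4 ^ b * opChar W (fun j => expOf (τ j)) (expOf b)) ∧
      (∀ j, 0 < τ j → matrixFW (fun x => (W j x)⁻¹) (expOf (τ j)) ≤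
        4 ^ τ j * opChar W (fun j => expOf (τ j)) (expOf b)) := by
  have hsum : 0 ≤ ∑ j, τ j := Finset.sum_nonneg fun j _ => hτ j
  have hsum' : ∀ j, 0 ≤ b + ∑ i ∈ Finset.univ.erase j, τ i := fun j =>
    add_nonneg hb (Finset.sum_nonneg fun j _ => hτ j)
  have hsplit : ∀ j, τ j + (b + ∑ i ∈ Finset.univ.erase j, τ i) = b + ∑ j, τ j := fun j => by
    rw [← Finset.add_sum_erase _ τ (Finset.mem_univ j)]
    ring
  refine ⟨iSup₂_le fun v hv => ?_, fun j => iSup₂_le fun v hv => ?_, fun hb' => iSup₂_le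
    fun v hv => ?_, fun j hj => iSup₂_le fun v hv => ?_⟩
  · exact scalarChar_rpow_le hb hsum (inv_pos.2 hpos) (mul_inv_cancel₀ hpos.ne') fun a ℓ hℓ =>
      eLpNorm_tensor_mul_eLpNorm_inv_le hW hb hτ v a hℓ
  · refine scalarChar_rpow_le (hτ j) (hsum' j) (inv_pos.2 hpos) ?_ fun a ℓ hℓ =>
      eLpNorm_inv_mul_eLpNorm_inv_le hn hW hb hτ j hv a hℓ
    rw [hsplit, mul_inv_cancel₀ hpos.ne']
  · rw [toReal_expOf hb, inv_inv]
    refine fujiiWilson_rpow_le (aemeasurable_normMul (aestronglyMeasurable_tensorMatrix hW) v)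
      ?_ hb' hsum fun a ℓ hℓ => eLpNorm_tensor_mul_eLpNorm_inv_le hW hb hτ v a hℓ
    filter_upwards [ae_posDef hW .rfl] with x hx
    exact ⟨normMul_ne_zero (tensorMatrix_inv_mul hx) hv, normMul_ne_top _ _⟩
  · rw [toReal_expOf (hτ j), inv_inv]
    refine fujiiWilson_rpow_le (aemeasurable_normMul (hW j).inv_aestronglyMeasurable v)
      ?_ hj (hsum' j) fun a ℓ hℓ => eLpNorm_inv_mul_eLpNorm_inv_le hn hW hb hτ j hv a hℓ
    filter_upwards [ae_posDef hW .rfl] with x hx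
    exact ⟨normMul_ne_zero (hx j).mul_inv_self hv, normMul_ne_top _ _⟩

end Directional

/-! ### Near-Auerbach bases -/

section Auerbach

variable {𝕜 : Type*} [RCLike 𝕜] {ι : Type*} [Fintype ι] [DecidableEq ι]

/-- The hypothesis says that K has trivial orthogonal complement, so K spans and contains a basis.
-/
theorem exists_det_ne_zero {K : Set (EuclideanSpace 𝕜 ι)}
    (hK : ∀ u : EuclideanSpace 𝕜 ι, u ≠ 0 → ∃ e ∈ K, inner 𝕜 u e ≠ 0) :
    ∃ e : ι → EuclideanSpace 𝕜 ι, (∀ i, e i ∈ K) ∧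
      (Matrix.of fun k i => e i k).det ≠ 0 := by
  have hspan : Submodule.span 𝕜 K = ⊤ := by
    rw [← Submodule.orthogonal_eq_bot_iff, Submodule.eq_bot_iff]
    intro u hu
    by_contra hu0
    obtain ⟨e, he, hne⟩ := hK u hu0
    exact hne (Submodule.inner_left_of_mem_orthogonal (Submodule.subset_span he) hu)
  obtain ⟨b, hbK, hb, hli⟩ := exists_linearIndependent 𝕜 K
  rw [hspan] at hb
  let B : Module.Basis b 𝕜 (EuclideanSpace 𝕜 ι) := Module.Basis.mk hli (by simp [hb])
  let σ : b ≃ ι := B.indexEquiv (EuclideanSpace.basisFun ι 𝕜).toBasis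
  refine ⟨fun i => (σ.symm i : EuclideanSpace 𝕜 ι), fun i => hbK (σ.symm i).2, ?_⟩
  have h1 : LinearIndependent 𝕜 fun i => (σ.symm i : EuclideanSpace 𝕜 ι) :=
    hli.comp _ σ.symm.injective
  have h2 : LinearIndependent 𝕜 fun i k => (σ.symm i : EuclideanSpace 𝕜 ι) k :=
    h1.map' (WithLp.linearEquiv 2 𝕜 (ι → 𝕜)).toLinearMap (LinearEquiv.ker _)
  have h3 := (Matrix.linearIndependent_cols_iff_isUnit
    (A := Matrix.of fun k i => (σ.symm i : EuclideanSpace 𝕜 ι) k)).1 h2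
  exact ((Matrix.isUnit_iff_isUnit_det _).1 h3).ne_zero

/-- A family in K whose determinant exceeds half the supremum has Cramer coefficients of size at
most 2. Accepting half avoids compactness of K. -/
theorem exists_near_auerbach {K : Set (EuclideanSpace 𝕜 ι)} {R : ℝ} (hR : ∀ e ∈ K, ‖e‖ ≤ R)
    (hK : ∀ u : EuclideanSpace 𝕜 ι, u ≠ 0 → ∃ e ∈ K, inner 𝕜 u e ≠ 0) :
    ∃ e : ι → EuclideanSpace 𝕜 ι, (∀ i, e i ∈ K) ∧
      ∀ x ∈ K, ∃ c : ι → 𝕜, (∀ i, ‖c i‖ ≤ 2) ∧ x = ∑ i, c i • e i := by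
  let δ : (ι → EuclideanSpace 𝕜 ι) → ℝ := fun e => ‖(Matrix.of fun k i => e i k).det‖
  let S : Set ℝ := δ '' {e | ∀ i, e i ∈ K}
  have hS : BddAbove S := by
    refine ⟨(Fintype.card ι).factorial • R ^ Fintype.card ι, ?_⟩
    rintro _ ⟨e, he, rfl⟩
    exact Matrix.det_le (abv := NormedField.toAbsoluteValue 𝕜) fun k i =>
      (PiLp.norm_apply_le (e i) k).trans (hR _ (he i))
  obtain ⟨e₀, he₀, hdet₀⟩ := exists_det_ne_zero hK
  have hpos : 0 < sSup S :=
    (norm_pos_iff.2 hdet₀).trans_le (le_csSup hS ⟨e₀, he₀, rfl⟩)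
  obtain ⟨_, ⟨e, he, rfl⟩, hlt⟩ :=
    exists_lt_of_lt_csSup (s := S) ⟨_, e₀, he₀, rfl⟩ (half_lt_self hpos)
  refine ⟨e, he, fun x hx => ?_⟩
  set A : Matrix ι ι 𝕜 := Matrix.of fun k i => e i k with hA
  have hA0 : 0 < ‖A.det‖ := (half_pos hpos).trans hlt
  refine ⟨fun i => A.det⁻¹ * A.cramer (fun k => x k) i, fun i => ?_, ?_⟩
  -- The numerator in Cramer's rule is the determinant of a competing family from K, with e_i
  -- replaced by x.
  · have h1 : ‖(A.updateCol i fun k => x k).det‖ ≤ sSup S := by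
      refine le_csSup hS ⟨Function.update e i x, fun i' => ?_, ?_⟩
      · by_cases h : i' = i
        · subst h; simpa using hx
        · simpa [h] using he i'
      · change ‖Matrix.det _‖ = _
        congr 2
        ext k i'
        by_cases h : i' = i
        · subst h; simp
        · simp [h, hA]
    dsimp only
    rw [Matrix.cramer_apply, norm_mul, norm_inv, inv_mul_le_iff₀ hA0]
    change sSup S / 2 < ‖A.det‖ at hlt
    linarith
  · ext k
    have h := congrFun (Matrix.mulVec_cramer A fun k => x k) k
    simp only [Matrix.mulVec, dotProduct, Pi.smul_apply, smul_eq_mul] at h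
    have hd : A.det ≠ 0 := norm_pos_iff.1 hA0
    calc x k = A.det⁻¹ * (A.det * x k) := by field_simp
      _ = A.det⁻¹ * ∑ i, A k i * A.cramer (fun k => x k) i := by rw [h]
      _ = _ := by
        rw [Finset.mul_sum]
        simp only [hA, Matrix.of_apply, WithLp.ofLp_sum, Finset.sum_apply, WithLp.ofLp_smul,
          Pi.smul_apply, smul_eq_mul]
        exact Finset.sum_congr rfl fun i _ => by ring

end Auerbach

/-! ### Duality of `L^p` quasinorms -/

section Duality

variable {α : Type*} [MeasurableSpace α] {μ : Measure α}

theorem exists_dual_function [IsProbabilityMeasure μ] {θ : ℝ} (h0 : 0 ≤ θ) (h1 : θ ≤ 1)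
    {h : α → ℝ≥0∞} (hm : AEMeasurable h μ) (hfin : ∀ x, h x ≠ ∞)
    (hN : eLpNorm h (expOf (1 - θ)) μ ≠ ∞) :
    ∃ g : α → ℝ≥0∞, AEMeasurable g μ ∧ (∀ x, g x ≠ ∞) ∧ eLpNorm g (expOf θ) μ ≤ 1 ∧
      eLpNorm h (expOf (1 - θ)) μ ≤ 2 * ∫⁻ x, h x * g x ∂μ := by
  set N := eLpNorm h (expOf (1 - θ)) μ with hNdef
  by_cases hN0 : N = 0
  · exact ⟨0, aemeasurable_const, by simp, by simp, by simp [hN0]⟩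
  -- For the essential supremum no extremiser need exist; the normalised indicator of {h > N/2}
  -- costs the factor 2. Otherwise (h/N) ^ (θ/(1-θ)) is extremal.
  rcases h1.eq_or_lt with rfl | h1
  · rw [sub_self, eLpNorm_expOf_zero] at hNdef
    have hlt : N / 2 < essSup h μ := hNdef ▸ ENNReal.half_lt_self hN0 hN
    have hE : μ {x | N / 2 < h x} ≠ 0 := by
      intro hE
      refine absurd (essSup_le_of_ae_le (μ := μ) (f := h) (N / 2) ?_) (not_le.2 hlt)
      refine (measure_eq_zero_iff_ae_notMem.1 hE).mono fun x hx => ?_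
      simpa using hx
    have hEt : μ {x | N / 2 < h x} ≠ ∞ := measure_ne_top _ _
    have hEm : NullMeasurableSet {x | N / 2 < h x} μ := nullMeasurableSet_lt aemeasurable_const hm
    refine ⟨{x | N / 2 < h x}.indicator fun _ => (μ {x | N / 2 < h x})⁻¹,
      aemeasurable_const.indicator₀ hEm, fun x => ?_, ?_, ?_⟩
    · by_cases hx : x ∈ {x | N / 2 < h x}
      · rw [Set.indicator_of_mem hx]
        simpa using hE
      · rw [Set.indicator_of_notMem hx]
        simp
    · rw [eLpNorm_expOf_of_pos one_pos]
      simp [lintegral_indicator_const₀ hEm, ENNReal.inv_mul_cancel hE hEt]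
    · have : N / 2 ≤ ∫⁻ x, h x * {x | N / 2 < h x}.indicator
          (fun _ => (μ {x | N / 2 < h x})⁻¹) x ∂μ := by
        calc N / 2 = ∫⁻ x, {x | N / 2 < h x}.indicator
              (fun _ => N / 2 * (μ {x | N / 2 < h x})⁻¹) x ∂μ := by
              rw [lintegral_indicator_const₀ hEm, mul_assoc, ENNReal.inv_mul_cancel hE hEt,
                mul_one]
          _ ≤ _ := by
            refine lintegral_mono fun x => Set.indicator_apply_le' (fun hx => ?_) (by simp)
            rw [Set.indicator_of_mem hx]
            exact mul_le_mul' (le_of_lt hx) le_rfl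
      calc N = 2 * (N / 2) := (ENNReal.mul_div_cancel two_ne_zero (by simp)).symm
        _ ≤ _ := by gcongr
  have hθ : 0 < 1 - θ := sub_pos.2 h1
  set k : α → ℝ≥0∞ := fun x => N⁻¹ * h x with hk
  have hkm : AEMeasurable k μ := hm.const_mul _
  have hk1 : eLpNorm k (expOf (1 - θ)) μ = 1 := by
    rw [hk, eLpNorm_const_mul hθ.le _ hm, ENNReal.inv_mul_cancel hN0 hN]
  have hkfin : ∀ x, k x ≠ ∞ := fun x => ENNReal.mul_ne_top (by simpa using hN0) (hfin x)
  have hρ : 0 ≤ θ / (1 - θ) := div_nonneg h0 hθ.le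
  refine ⟨fun x => k x ^ (θ / (1 - θ)), hkm.pow_const _,
    fun x => ENNReal.rpow_ne_top_of_nonneg hρ (hkfin x), ?_, ?_⟩
  · rcases h0.eq_or_lt with rfl | h0
    · simp only [zero_div, ENNReal.rpow_zero, eLpNorm_expOf_zero]
      exact essSup_le_of_ae_le _ (Filter.Eventually.of_forall fun _ => le_rfl)
    · have := eLpNorm_rpow (μ := μ) (a := 1 - θ) (div_pos h0 hθ) k
      rw [mul_div_cancel₀ _ hθ.ne', hk1, ENNReal.one_rpow] at this
      exact this.le
  · have hint : ∫⁻ x, k x ^ (1 - θ)⁻¹ ∂μ = 1 := by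
      rw [eLpNorm_expOf_of_pos hθ] at hk1
      simpa [hθ.ne'] using congrArg (· ^ (1 - θ)⁻¹) hk1
    have hprod : ∀ x, h x * k x ^ (θ / (1 - θ)) = N * k x ^ (1 - θ)⁻¹ := fun x => by
      have hx : h x = N * k x := by
        rw [hk, ← mul_assoc, ENNReal.mul_inv_cancel hN0 hN, one_mul]
      have he : (1 - θ)⁻¹ = 1 + θ / (1 - θ) := by field_simp; ring
      rw [he, ENNReal.rpow_add_of_nonneg _ _ zero_le_one hρ, ENNReal.rpow_one, ← mul_assoc, ← hx]
    simp_rw [hprod]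
    rw [lintegral_const_mul'' _ (hkm.pow_const _), hint, mul_one]
    exact le_mul_of_one_le_left zero_le one_le_two

end Duality

/-! ### The Muckenhoupt condition bounds the operator characteristic -/

section Muckenhoupt

variable {𝕜 : Type*} [RCLike 𝕜] {d : ℕ}

section SingleWeight

variable {ι : Type*} [Fintype ι] [DecidableEq ι] {W : (Fin d → ℝ) → Matrix ι ι 𝕜}
  {μ : Measure (Fin d → ℝ)}

theorem aestronglyMeasurable_clm_apply {α E : Type*} [MeasurableSpace α] {μ : Measure α}
    [NormedAddCommGroup E] [NormedSpace 𝕜 E] {T : α → E →L[𝕜] E} {f : α → E}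
    (hT : AEStronglyMeasurable T μ) (hf : AEStronglyMeasurable f μ) :
    AEStronglyMeasurable (fun x => T x (f x)) μ := by
  have h : Continuous fun p : (E →L[𝕜] E) × E => p.1 p.2 := isBoundedBilinearMap_apply.continuous
  exact h.comp_aestronglyMeasurable (hT.prodMk hf)

theorem aestronglyMeasurable_toEuclideanCLM_apply_fun {A : (Fin d → ℝ) → Matrix ι ι 𝕜}
    (hA : AEStronglyMeasurable A μ) {f : (Fin d → ℝ) → EuclideanSpace 𝕜 ι}
    (hf : AEStronglyMeasurable f μ) :
    AEStronglyMeasurable (fun x => Matrix.toEuclideanCLM (n := ι) (𝕜 := 𝕜) (A x) (f x)) μ := by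
  exact aestronglyMeasurable_clm_apply
    (T := fun x => Matrix.toEuclideanCLM (n := ι) (𝕜 := 𝕜) (A x))
    (continuous_toEuclideanCLM.comp_aestronglyMeasurable hA) hf

/-- The set of averages of functions in the unit ball of `L^p_W(μ)`, where `θ = 1/p`. -/
def averageSet (W : (Fin d → ℝ) → Matrix ι ι 𝕜) (θ : ℝ) (μ : Measure (Fin d → ℝ)) :
    Set (EuclideanSpace 𝕜 ι) :=
  {e | ∃ f : (Fin d → ℝ) → EuclideanSpace 𝕜 ι, AEStronglyMeasurable f μ ∧
    eLpNorm (fun x => normMul (W x) (f x)) (expOf θ) μ ≤ 1 ∧ e = ∫ x, f x ∂μ}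

/-- Hölder applied to ‖f‖ ≤ ‖W⁻¹‖ ‖Wf‖. It makes `averageSet` bounded and its representing functions
integrable. -/
theorem lintegral_enorm_le (hW : IsMatrixWeight W) (hμ : μ ≪ volume) {θ : ℝ} (h0 : 0 ≤ θ)
    (h1 : θ ≤ 1) {f : (Fin d → ℝ) → EuclideanSpace 𝕜 ι} (hf : AEStronglyMeasurable f μ)
    (hf1 : eLpNorm (fun x => normMul (W x) (f x)) (expOf θ) μ ≤ 1) :
    ∫⁻ x, ‖f x‖ₑ ∂μ ≤ eLpNorm (fun x => opNorm (W x)⁻¹) (expOf (1 - θ)) μ := by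
  have hm1 : AEMeasurable (fun x => opNorm (W x)⁻¹) μ :=
    aemeasurable_opNorm (hW.inv_aestronglyMeasurable.mono_ac hμ)
  have hm2 : AEMeasurable (fun x => normMul (W x) (f x)) μ :=
    (aestronglyMeasurable_toEuclideanCLM_apply_fun (hW.aestronglyMeasurable.mono_ac hμ) hf).enorm
  calc ∫⁻ x, ‖f x‖ₑ ∂μ ≤ ∫⁻ x, opNorm (W x)⁻¹ * normMul (W x) (f x) ∂μ := by
        refine lintegral_mono_ae ?_
        filter_upwards [hμ.ae_le hW.2] with x hx
        have := normMul_mul_le (W x)⁻¹ (W x) (f x)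
        rwa [hx.inv_mul_self, normMul_one] at this
    _ = eLpNorm (fun x => opNorm (W x)⁻¹ * normMul (W x) (f x)) (expOf (1 - θ + θ)) μ := by
        rw [sub_add_cancel, eLpNorm_expOf_of_pos one_pos]
        simp
    _ ≤ _ := (eLpNorm_mul_le (by linarith) h0 hm1 hm2).trans (mul_le_of_le_one_right' hf1)

theorem enorm_le_of_mem_averageSet (hW : IsMatrixWeight W) (hμ : μ ≪ volume) {θ : ℝ} (h0 : 0 ≤ θ)
    (h1 : θ ≤ 1) {e : EuclideanSpace 𝕜 ι} (he : e ∈ averageSet W θ μ) :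
    ‖e‖ₑ ≤ eLpNorm (fun x => opNorm (W x)⁻¹) (expOf (1 - θ)) μ := by
  obtain ⟨f, hf, hf1, rfl⟩ := he
  exact (enorm_integral_le_lintegral_enorm f).trans (lintegral_enorm_le hW hμ h0 h1 hf hf1)

theorem eLpNorm_normMul_inv_le (hW : IsMatrixWeight W) (hμ : μ ≪ volume) {θ : ℝ} (h1 : θ ≤ 1)
    (u : EuclideanSpace 𝕜 ι) :
    eLpNorm (fun x => normMul (W x)⁻¹ u) (expOf (1 - θ)) μ ≤
      ‖u‖ₑ * eLpNorm (fun x => opNorm (W x)⁻¹) (expOf (1 - θ)) μ := by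
  rw [← eLpNorm_const_mul (by linarith) _
    (aemeasurable_opNorm (hW.inv_aestronglyMeasurable.mono_ac hμ))]
  refine eLpNorm_mono_enorm fun x => ?_
  simp only [enorm_eq_self]
  rw [mul_comm]
  exact normMul_le _ _

/-- Duality: averages of unit functions in `L^p_W` norm the functional `u ↦ ‖W⁻¹ u‖_{p'}`. -/
theorem exists_mem_averageSet [IsProbabilityMeasure μ] (hW : IsMatrixWeight W) (hμ : μ ≪ volume)
    {θ : ℝ} (h0 : 0 ≤ θ) (h1 : θ ≤ 1)
    (hfin : eLpNorm (fun x => opNorm (W x)⁻¹) (expOf (1 - θ)) μ ≠ ∞) (u : EuclideanSpace 𝕜 ι) :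
    ∃ e ∈ averageSet W θ μ,
      eLpNorm (fun x => normMul (W x)⁻¹ u) (expOf (1 - θ)) μ ≤ 2 * ‖(inner 𝕜 u e : 𝕜)‖ₑ := by
  have hinv := hW.inv_aestronglyMeasurable.mono_ac hμ
  obtain ⟨g, hg, hgfin, hg1, hgN⟩ := exists_dual_function (μ := μ) h0 h1
    (aemeasurable_normMul hinv u) (fun x => normMul_ne_top _ u)
    (ne_top_of_le_ne_top (by finiteness) (eLpNorm_normMul_inv_le hW hμ h1 u))
  let T : Matrix ι ι 𝕜 → EuclideanSpace 𝕜 ι →L[𝕜] EuclideanSpace 𝕜 ι :=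
    fun A => Matrix.toEuclideanCLM (n := ι) (𝕜 := 𝕜) A
  let w : (Fin d → ℝ) → EuclideanSpace 𝕜 ι := fun x => T (W x)⁻¹ u
  have hw : AEStronglyMeasurable w μ := aestronglyMeasurable_toEuclideanCLM_apply hinv u
  let c : (Fin d → ℝ) → ℝ := fun x => (g x).toReal * ‖w x‖⁻¹
  have hc : AEMeasurable c μ := hg.ennreal_toReal.mul hw.norm.aemeasurable.inv
  have hc0 : ∀ x, 0 ≤ c x := fun x => by positivity
  -- With w = W⁻¹u this is g W⁻¹(w/‖w‖), and 0 where w = 0. Thus ‖Wf‖ ≤ g, while ⟨u, f⟩ = g‖w‖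
  -- almost everywhere because W⁻¹ is Hermitian.
  let f : (Fin d → ℝ) → EuclideanSpace 𝕜 ι := fun x => (c x : 𝕜) • T (W x)⁻¹ (w x)
  have hf : AEStronglyMeasurable f μ :=
    (RCLike.continuous_ofReal.comp_aestronglyMeasurable hc.aestronglyMeasurable).fun_smul
      (aestronglyMeasurable_toEuclideanCLM_apply_fun hinv hw)
  have hf1 : eLpNorm (fun x => normMul (W x) (f x)) (expOf θ) μ ≤ 1 := by
    refine (eLpNorm_mono_enorm_ae ?_).trans hg1
    filter_upwards [hμ.ae_le hW.2] with x hx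
    simp only [enorm_eq_self]
    have h2 : T (W x) (f x) = (c x : 𝕜) • w x := by
      have : T (W x) (T (W x)⁻¹ (w x)) = w x := by
        change (T (W x) * T (W x)⁻¹) (w x) = w x
        simp only [T]
        rw [← map_mul, hx.mul_inv_self, map_one]
        rfl
      simp only [f, map_smul, this]
    have h3 : normMul (W x) (f x) = ‖T (W x) (f x)‖ₑ := rfl
    rw [h3, h2, ← ofReal_norm, norm_smul, RCLike.norm_ofReal, abs_of_nonneg (hc0 x)]
    refine (ENNReal.ofReal_le_ofReal (?_ : _ ≤ (g x).toReal)).trans_eq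
      (ENNReal.ofReal_toReal (hgfin x))
    rw [mul_assoc]
    exact mul_le_of_le_one_right ENNReal.toReal_nonneg inv_mul_le_one
  have hfint : Integrable f μ :=
    ⟨hf, (lintegral_enorm_le hW hμ h0 h1 hf hf1).trans_lt hfin.lt_top⟩
  refine ⟨∫ x, f x ∂μ, ⟨f, hf, hf1, rfl⟩, hgN.trans ?_⟩
  gcongr
  have hinner : ∀ᵐ x ∂μ, inner 𝕜 u (f x) = (((g x).toReal * ‖w x‖ : ℝ) : 𝕜) := by
    filter_upwards [hμ.ae_le hW.2] with x hx
    have hadj : inner 𝕜 u (T (W x)⁻¹ (w x)) = inner 𝕜 (w x) (w x) := by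
      have : ContinuousLinearMap.adjoint (T (W x)⁻¹) = T (W x)⁻¹ := by
        rw [← ContinuousLinearMap.star_eq_adjoint]
        simp only [T]
        rw [← map_star, Matrix.star_eq_conjTranspose, hx.isHermitian.inv.eq]
      rw [← ContinuousLinearMap.adjoint_inner_left, this]
    simp only [f]
    rw [inner_smul_right, hadj, inner_self_eq_norm_sq_to_K]
    simp only [c]
    norm_cast
    rcases eq_or_ne ‖w x‖ 0 with h | h
    · simp [h]
    · field_simp
  have hint : inner 𝕜 u (∫ x, f x ∂μ) = ((∫ x, (g x).toReal * ‖w x‖ ∂μ : ℝ) : 𝕜) := by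
    rw [← integral_inner hfint, ← integral_ofReal]
    exact integral_congr_ae hinner
  have hint' : Integrable (fun x => (g x).toReal * ‖w x‖) μ := by
    have h3 : Integrable (fun x => inner 𝕜 u (f x)) μ := hfint.const_inner u
    refine (h3.norm).congr ?_
    filter_upwards [hinner] with x hx
    rw [hx, RCLike.norm_ofReal, abs_of_nonneg (by positivity)]
  rw [hint, ← ofReal_norm, RCLike.norm_ofReal,
    abs_of_nonneg (integral_nonneg fun x => by positivity),
    ofReal_integral_eq_lintegral_ofReal hint' (Filter.Eventually.of_forall fun x => by positivity)]
  refine lintegral_mono fun x => ?_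
  rw [ENNReal.ofReal_mul ENNReal.toReal_nonneg, ENNReal.ofReal_toReal (hgfin x), ofReal_norm,
    mul_comm]
  exact le_rfl

theorem opNorm_le_sum (A : Matrix ι ι 𝕜) :
    opNorm A ≤ ∑ k, normMul A (EuclideanSpace.single k 1) := by
  have h : ∀ v : EuclideanSpace 𝕜 ι, ‖Matrix.toEuclideanCLM (n := ι) (𝕜 := 𝕜) A v‖ ≤
      (∑ k, ‖Matrix.toEuclideanCLM (n := ι) (𝕜 := 𝕜) A (EuclideanSpace.single k 1)‖) * ‖v‖ := by
    intro v
    have hv : v = ∑ k, v k • EuclideanSpace.single k (1 : 𝕜) := by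
      conv_lhs => rw [← (EuclideanSpace.basisFun ι 𝕜).sum_repr v]
      simp
    conv_lhs => rw [hv, map_sum]
    rw [Finset.sum_mul]
    refine norm_sum_le_of_le _ fun k _ => ?_
    rw [map_smul, norm_smul, mul_comm]
    exact mul_le_mul_of_nonneg_left (PiLp.norm_apply_le v k) (norm_nonneg _)
  have h2 := ContinuousLinearMap.opNorm_le_bound _ (Finset.sum_nonneg fun k _ => norm_nonneg _) h
  rw [opNorm, ← ofReal_norm]
  refine (ENNReal.ofReal_le_ofReal h2).trans ?_
  rw [ENNReal.ofReal_sum_of_nonneg fun k _ => norm_nonneg _]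
  simp [normMul]

theorem normMul_sum_smul_le (A : Matrix ι ι 𝕜) {c : ι → 𝕜} (hc : ∀ i, ‖c i‖ ≤ 2)
    (e : ι → EuclideanSpace 𝕜 ι) :
    normMul A (∑ i, c i • e i) ≤ 2 * ∑ i, normMul A (e i) := by
  rw [normMul, map_sum, Finset.mul_sum]
  refine (enorm_sum_le _ _).trans (Finset.sum_le_sum fun i _ => ?_)
  rw [map_smul, enorm_smul]
  refine mul_le_mul' ?_ le_rfl
  rw [← ofReal_norm]
  exact (ENNReal.ofReal_le_ofReal (hc i)).trans_eq (by simp)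

theorem enorm_inner_normMul_le {A : Matrix ι ι 𝕜} (hA : A.PosDef) (k : ι)
    (e : EuclideanSpace 𝕜 ι) :
    ‖(inner 𝕜 (Matrix.toEuclideanCLM (n := ι) (𝕜 := 𝕜) A (EuclideanSpace.single k 1)) e : 𝕜)‖ₑ ≤
      normMul A e := by
  have hadj : ContinuousLinearMap.adjoint (Matrix.toEuclideanCLM (n := ι) (𝕜 := 𝕜) A) =
      Matrix.toEuclideanCLM (n := ι) (𝕜 := 𝕜) A := by
    rw [← ContinuousLinearMap.star_eq_adjoint, ← map_star, Matrix.star_eq_conjTranspose,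
      hA.isHermitian.eq]
  rw [← hadj, ContinuousLinearMap.adjoint_inner_left, normMul, enorm_le_iff_norm_le]
  refine (norm_inner_le_norm _ _).trans ?_
  simp

/-- Finitely many averages control the averaged operator norm. -/
theorem exists_controlling_averages [IsProbabilityMeasure μ] (hW : IsMatrixWeight W)
    (hμ : μ ≪ volume) {θ : ℝ} (h0 : 0 ≤ θ) (h1 : θ ≤ 1)
    (hfin : eLpNorm (fun x => opNorm (W x)⁻¹) (expOf (1 - θ)) μ ≠ ∞) :
    ∃ e : ι → EuclideanSpace 𝕜 ι, (∀ i, e i ∈ averageSet W θ μ) ∧ ∀ x, (W x).PosDef →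
      eLpNorm (fun y => opNorm (W x * (W y)⁻¹)) (expOf (1 - θ)) μ ≤
        4 * Fintype.card ι * ∑ i, normMul (W x) (e i) := by
  have hinv := hW.inv_aestronglyMeasurable.mono_ac hμ
  have hbdd : ∀ e ∈ averageSet W θ μ,
      ‖e‖ ≤ (eLpNorm (fun x => opNorm (W x)⁻¹) (expOf (1 - θ)) μ).toReal := fun e he => by
    have := enorm_le_of_mem_averageSet hW hμ h0 h1 he
    rw [← ofReal_norm] at this
    exact (ENNReal.ofReal_le_iff_le_toReal hfin).1 this
  have hsep : ∀ u : EuclideanSpace 𝕜 ι, u ≠ 0 → ∃ e ∈ averageSet W θ μ, inner 𝕜 u e ≠ 0 := by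
    intro u hu
    obtain ⟨e, he, hle⟩ := exists_mem_averageSet hW hμ h0 h1 hfin u
    refine ⟨e, he, fun h => ?_⟩
    rw [h, enorm_zero, mul_zero, le_zero_iff,
      eLpNorm_eq_zero_iff (aemeasurable_normMul hinv u).aestronglyMeasurable
        (expOf_ne_zero _)] at hle
    obtain ⟨x, hx, hx'⟩ := (hle.and (hμ.ae_le hW.2)).exists
    exact normMul_ne_zero hx'.mul_inv_self hu hx
  obtain ⟨e, he, hspan⟩ := exists_near_auerbach hbdd hsep
  refine ⟨e, he, fun x hx => ?_⟩
  have hp : 1 ≤ expOf (1 - θ) := by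
    rw [expOf, ENNReal.one_le_inv, ENNReal.ofReal_le_one]
    linarith
  -- Since ‖W(x)W(y)⁻¹‖ = ‖W(y)⁻¹W(x)‖, it suffices to test the columns of W(x). Duality and the
  -- coefficient bound cost 2 each, the number of columns gives the cardinality, and the e_i do not
  -- depend on x.
  let b : ι → EuclideanSpace 𝕜 ι := fun k =>
    Matrix.toEuclideanCLM (n := ι) (𝕜 := 𝕜) (W x) (EuclideanSpace.single k 1)
  have hb : ∀ k, eLpNorm (fun y => normMul (W y)⁻¹ (b k)) (expOf (1 - θ)) μ ≤
      4 * ∑ i, normMul (W x) (e i) := by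
    intro k
    obtain ⟨v, hv, hle⟩ := exists_mem_averageSet hW hμ h0 h1 hfin (b k)
    obtain ⟨c, hc, rfl⟩ := hspan v hv
    calc _ ≤ _ := hle
      _ ≤ 2 * (2 * ∑ i, normMul (W x) (e i)) :=
        mul_le_mul' le_rfl ((enorm_inner_normMul_le hx k _).trans (normMul_sum_smul_le _ hc e))
      _ = _ := by ring
  calc eLpNorm (fun y => opNorm (W x * (W y)⁻¹)) (expOf (1 - θ)) μ
      ≤ eLpNorm (∑ k, fun y => normMul (W y)⁻¹ (b k)) (expOf (1 - θ)) μ := by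
        refine eLpNorm_mono_enorm_ae ?_
        filter_upwards [hμ.ae_le hW.2] with y hy
        simp only [enorm_eq_self, Finset.sum_apply]
        rw [← opNorm_inv_mul hx hy]
        refine (opNorm_le_sum _).trans_eq (Finset.sum_congr rfl fun k _ => ?_)
        rw [normMul, map_mul]
        rfl
    _ ≤ ∑ k, eLpNorm (fun y => normMul (W y)⁻¹ (b k)) (expOf (1 - θ)) μ :=
        eLpNorm_sum_le (fun k _ => (aemeasurable_normMul hinv _).aestronglyMeasurable) hp
    _ ≤ ∑ _k : ι, 4 * ∑ i, normMul (W x) (e i) := Finset.sum_le_sum fun k _ => hb k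
    _ = _ := by
        rw [Finset.sum_const, Finset.card_univ, nsmul_eq_mul]
        ring

end SingleWeight

end Muckenhoupt

/-! ### Testing the averaging operators and finiteness of the operator characteristic -/

section Testing

variable {𝕜 : Type*} [RCLike 𝕜] {d m : ℕ} {n : Fin m → ℕ}
  {W : ∀ j, (Fin d → ℝ) → Matrix (Fin (n j)) (Fin (n j)) 𝕜} {p : Fin m → ℝ≥0∞}

theorem restrict_cube_eq_smul_avgMeasure (a : Fin d → ℝ) {ℓ : ℝ} (hℓ : 0 < ℓ) :
    volume.restrict (cube a ℓ) = volume (cube a ℓ) • avgMeasure a ℓ := by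
  rw [avgMeasure, smul_smul, ENNReal.mul_inv_cancel (volume_cube_ne_zero a hℓ)
    (volume_cube_ne_top a ℓ), one_smul]

theorem eLpNorm_restrict_cube (a : Fin d → ℝ) {ℓ : ℝ} (hℓ : 0 < ℓ) (f : (Fin d → ℝ) → ℝ≥0∞)
    (q : ℝ≥0∞) :
    eLpNorm f q (volume.restrict (cube a ℓ)) =
      volume (cube a ℓ) ^ invExp q * eLpNorm f q (avgMeasure a ℓ) := by
  rw [restrict_cube_eq_smul_avgMeasure a hℓ, eLpNorm_smul_measure_of_ne_zero
    (volume_cube_ne_zero a hℓ), smul_eq_mul, one_div]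
  rfl

/-- Apply T_Q to functions representing the e_j, cut off to Q: it returns ⨂ e_j on Q. The powers of
|Q| cancel because 1/p = ∑ 1/p_j. -/
theorem IsMuckenhoupt.exists_testing (h : IsMuckenhoupt W p) (hp : ∀ j, 1 ≤ p j) :
    ∃ C : ℝ≥0∞, C ≠ ∞ ∧ ∀ (a : Fin d → ℝ) (ℓ : ℝ), 0 < ℓ →
      ∀ e : ∀ j, EuclideanSpace 𝕜 (Fin (n j)),
        (∀ j, e j ∈ averageSet (W j) (invExp (p j)) (avgMeasure a ℓ)) →
          eLpNorm (fun x => ∏ j, normMul (W j x) (e j)) (harm p) (avgMeasure a ℓ) ≤ C := by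
  have hp0 : ∀ j, p j ≠ 0 := fun j => (one_pos.trans_le (hp j)).ne'
  set S := ⨆ (a : Fin d → ℝ) (ℓ : ℝ) (_ : 0 < ℓ), avgOpNorm W p a ℓ with hS
  have hSfin : S ≠ ∞ := h.2.ne
  -- The margin 1 yields an admissible constant below S + 1 without the infimum being attained.
  refine ⟨S + 1, by finiteness, fun a ℓ hℓ e he => ?_⟩
  have hlt : avgOpNorm W p a ℓ < S + 1 :=
    (hS ▸ le_iSup_of_le a (le_iSup_of_le ℓ (le_iSup_of_le hℓ le_rfl)) :
      avgOpNorm W p a ℓ ≤ S).trans_lt (ENNReal.lt_add_right hSfin one_ne_zero)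
  obtain ⟨C, hC, hCS⟩ := sInf_lt_iff.1 hlt
  choose f hf hf1 hfe using he
  have hQ := measurableSet_cube a ℓ
  set V := volume (cube a ℓ) with hV
  have hV0 : V ≠ 0 := volume_cube_ne_zero a hℓ
  have hVt : V ≠ ∞ := volume_cube_ne_top a ℓ
  let g : ∀ j, (Fin d → ℝ) → EuclideanSpace 𝕜 (Fin (n j)) := fun j => (cube a ℓ).indicator (f j)
  -- Stated for general index types, to serve both the weights W_j and the tensor weight.
  have hind : ∀ {ι : Type} [Fintype ι] [DecidableEq ι] (U : (Fin d → ℝ) → Matrix ι ι 𝕜)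
      (q : ℝ≥0∞) (φ : (Fin d → ℝ) → EuclideanSpace 𝕜 ι),
      wNorm U q ((cube a ℓ).indicator φ) =
        V ^ invExp q * eLpNorm (fun x => normMul (U x) (φ x)) q (avgMeasure a ℓ) := by
    intro ι _ _ U q φ
    have : (fun x => normMul (U x) ((cube a ℓ).indicator φ x)) =
        (cube a ℓ).indicator fun x => normMul (U x) (φ x) := by
      funext x
      by_cases hx : x ∈ cube a ℓ
      · simp [hx]
      · simp [hx, normMul]
    rw [wNorm, this, eLpNorm_indicator_eq_eLpNorm_restrict hQ, eLpNorm_restrict_cube a hℓ]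
  have hg : ∀ j, wNorm (W j) (p j) (g j) ≤ V ^ invExp (p j) := fun j => by
    rw [hind]
    refine mul_le_of_le_one_right' ?_
    have := hf1 j
    rwa [expOf_invExp (hp0 j)] at this
  have hgm : ∀ j, AEStronglyMeasurable (g j) volume := fun j => by
    refine (aestronglyMeasurable_indicator_iff hQ).2 ?_
    rw [restrict_cube_eq_smul_avgMeasure a hℓ]
    exact (hf j).smul_measure _
  have hfin : ∀ x : ℝ, 0 ≤ x → V ^ x ≠ ∞ := fun x hx => ENNReal.rpow_ne_top_of_nonneg hx hVt
  have hT := hC g fun j => ⟨hgm j, (hg j).trans_lt (hfin _ (invExp_nonneg _)).lt_top⟩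
  have havg : ∀ j, ⨍ y in cube a ℓ, g j y = e j := fun j => by
    rw [hfe j, average, Measure.restrict_apply_univ]
    refine integral_congr_ae (Measure.smul_absolutelyContinuous.ae_le ?_)
    filter_upwards [ae_restrict_mem hQ] with x hx
    exact Set.indicator_of_mem hx _
  have hLHS : wNorm (fun x => tensorMatrix fun j => W j x) (harm p) (avgOp a ℓ g) =
      V ^ invExp (harm p) *
        eLpNorm (fun x => ∏ j, normMul (W j x) (e j)) (harm p) (avgMeasure a ℓ) := by
    rw [avgOp, hind]
    simp only [havg, normMul_tensorMatrix_tensorVec]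
  have hprod : ∏ j, wNorm (W j) (p j) (g j) ≤ V ^ invExp (harm p) := by
    refine (Finset.prod_le_prod' fun j _ => hg j).trans_eq ?_
    rw [invExp_harm hp0]
    have hadd : ∀ s : Finset (Fin m),
        ∏ j ∈ s, V ^ invExp (p j) = V ^ ∑ j ∈ s, invExp (p j) := fun s => by
      induction s using Finset.induction_on with
      | empty => simp
      | insert i s hi ih =>
        rw [Finset.prod_insert hi, Finset.sum_insert hi, ih, ENNReal.rpow_add _ _ hV0 hVt]
    exact hadd _
  rw [hLHS] at hT
  have h1 : V ^ invExp (harm p) *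
      eLpNorm (fun x => ∏ j, normMul (W j x) (e j)) (harm p) (avgMeasure a ℓ) ≤
        V ^ invExp (harm p) * (S + 1) := by
    refine hT.trans ?_
    rw [mul_comm]
    exact mul_le_mul' hprod hCS.le
  exact (ENNReal.mul_le_mul_iff_right (ENNReal.rpow_pos hV0.bot_lt hVt).ne'
    (hfin _ (invExp_nonneg _))).1 h1

theorem conjExponent_eq_expOf {q : ℝ≥0∞} (hq : 1 ≤ q) :
    q.conjExponent = expOf (1 - invExp q) := by
  have h1 : invExp q ≤ 1 := by
    rw [invExp, ← ENNReal.toReal_one]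
    exact ENNReal.toReal_mono ENNReal.one_ne_top (ENNReal.inv_le_one.2 hq)
  conv_lhs => rw [← expOf_invExp (one_pos.trans_le hq).ne']
  exact conjExponent_expOf (invExp_nonneg q) h1

theorem IsMuckenhoupt.opChar_lt_top (hW : ∀ j, IsMatrixWeight (W j)) (h : IsMuckenhoupt W p)
    (hp : ∀ j, 1 ≤ p j) :
    opChar W (fun j => expOf (1 - invExp (p j))) (harm p) < ∞ := by
  have hp0 : ∀ j, p j ≠ 0 := fun j => (one_pos.trans_le (hp j)).ne'
  have hp1 : ∀ j, invExp (p j) ≤ 1 := fun j => by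
    rw [invExp, ← ENNReal.toReal_one]
    exact ENNReal.toReal_mono ENNReal.one_ne_top (ENNReal.inv_le_one.2 (hp j))
  obtain ⟨C, hC, htest⟩ := h.exists_testing hp
  have hharm : expOf (invExp (harm p)) = harm p := expOf_invExp (harm_ne_zero hp0)
  obtain ⟨D, hD, hsum⟩ := exists_eLpNorm_sum_le (invExp (harm p))
    (Finset.univ : Finset (∀ j, Fin (n j)))
  set B : ℝ≥0∞ := ∏ j, (4 * (n j : ℝ≥0∞)) with hB
  have hBfin : B ≠ ∞ := ENNReal.prod_ne_top fun j _ => by finiteness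
  have hfin : B * (D * C) < ∞ := by finiteness
  refine lt_of_le_of_lt ?_ hfin
  refine iSup_le fun a => iSup_le fun ℓ => iSup_le fun hℓ => ?_
  have := isProbabilityMeasure_avgMeasure a hℓ
  have hac := avgMeasure_absolutelyContinuous a ℓ
  have hloc : ∀ j, eLpNorm (fun x => opNorm (W j x)⁻¹) (expOf (1 - invExp (p j)))
      (avgMeasure a ℓ) ≠ ∞ := fun j => by
    have h1 := h.1 j a ℓ hℓ
    rw [eLpNorm_restrict_cube a hℓ, conjExponent_eq_expOf (hp j)] at h1
    intro h2
    rw [h2, ENNReal.mul_top (ENNReal.rpow_pos (volume_cube_ne_zero a hℓ).bot_lt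
      (volume_cube_ne_top a ℓ)).ne'] at h1
    exact lt_irrefl _ h1
  choose e he hle using fun j => exists_controlling_averages (hW j) hac (invExp_nonneg (p j))
    (hp1 j) (hloc j)
  have hmeas : ∀ i : ∀ j, Fin (n j),
      AEMeasurable (fun x => ∏ j, normMul (W j x) (e j (i j))) (avgMeasure a ℓ) := fun i =>
    Finset.aemeasurable_fun_prod _ fun j _ =>
      aemeasurable_normMul ((hW j).aestronglyMeasurable.mono_ac hac) _
  calc _ ≤ eLpNorm (fun x => B * ∑ i : ∀ j, Fin (n j), ∏ j, normMul (W j x) (e j (i j)))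
        (expOf (invExp (harm p))) (avgMeasure a ℓ) := by
        rw [hharm]
        refine eLpNorm_mono_enorm_ae ?_
        filter_upwards [ae_posDef hW hac] with x hx
        simp only [enorm_eq_self]
        refine (Finset.prod_le_prod' fun j _ => hle j x (hx j)).trans_eq ?_
        -- The product of sums expands into a sum over multi-indices, each term being a tested pure
        -- tensor.
        rw [Finset.prod_mul_distrib, Finset.prod_univ_sum, Fintype.piFinset_univ]
        simp [hB]
    _ ≤ B * (D * C) := by
        rw [eLpNorm_const_mul (invExp_nonneg _) _
          (Finset.aemeasurable_fun_sum _ fun i _ => hmeas i)]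
        gcongr
        refine hsum _ _ _ hmeas C fun i => ?_
        rw [hharm]
        exact htest a ℓ hℓ _ fun j => he j (i j)

end Testing

/-! ### The bounds in terms of the original exponents -/

section Assembly

variable {𝕜 : Type*} [RCLike 𝕜] {d m : ℕ} {n : Fin m → ℕ}
  {W : ∀ j, (Fin d → ℝ) → Matrix (Fin (n j)) (Fin (n j)) 𝕜} {p : Fin m → ℝ≥0∞} {r : Fin m → ℝ}
  {s : WithTop ℝ}

theorem invExp_le_inv {q : ℝ≥0∞} {x : ℝ} (hx : 0 < x) (h : ENNReal.ofReal x ≤ q) :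
    invExp q ≤ x⁻¹ := by
  have h1 : q⁻¹ ≤ ENNReal.ofReal x⁻¹ := by
    rw [ENNReal.ofReal_inv_of_pos hx]
    exact ENNReal.inv_le_inv.2 h
  exact ENNReal.toReal_le_of_le_ofReal (inv_nonneg.2 hx.le) h1

theorem invExp_ne_inv {q : ℝ≥0∞} {x : ℝ} (hx : 0 < x) (h : ENNReal.ofReal x ≤ q)
    (hne : q ≠ ENNReal.ofReal x) : invExp q ≠ x⁻¹ := by
  intro h1
  have hq : q ≠ 0 := ((ENNReal.ofReal_pos.2 hx).trans_le h).ne'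
  apply hne
  rw [← expOf_invExp hq, h1, expOf_of_pos (inv_pos.2 hx), inv_inv]

theorem sub_invTop_pos (hm : 0 < m) (hr : ∀ j, 0 < r j) (hs : invTop s ≤ ∑ j, (r j)⁻¹)
    (hrs : (((∑ j, (r j)⁻¹)⁻¹ : ℝ) : WithTop ℝ) ≠ s) : 0 < (∑ j, (r j)⁻¹) - invTop s := by
  have : Nonempty (Fin m) := ⟨⟨0, hm⟩⟩
  have hpos : 0 < ∑ j, (r j)⁻¹ :=
    Finset.sum_pos (fun j _ => inv_pos.2 (hr j)) Finset.univ_nonempty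
  induction s with
  | top => simpa [invTop] using hpos
  | coe s =>
    refine sub_pos.2 (lt_of_le_of_ne hs fun h => hrs ?_)
    rw [← h]
    simp [invTop]

theorem opCharRS_bounds (hm : 0 < m) (hn : ∀ j, 0 < n j) (hr : ∀ j, 0 < r j)
    (hpr : ∀ j, ENNReal.ofReal (r j) ≤ p j) (hs : invTop s ≤ invExp (harm p))
    (hrs : (((∑ j, (r j)⁻¹)⁻¹ : ℝ) : WithTop ℝ) ≠ s) (hW : ∀ j, IsMatrixWeight (W j)) :
    directionalChar (fun x => tensorMatrix fun j => W j x) ((∑ j, (r j)⁻¹) - invTop s)⁻¹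
        (expOf ((invExp (harm p) - invTop s) / ((∑ j, (r j)⁻¹) - invTop s))) ≤ opCharRS W p r s ∧
      (∀ j, directionalChar (fun x => (W j x)⁻¹) ((∑ j, (r j)⁻¹) - invTop s)⁻¹
        (expOf ((r j)⁻¹ - invExp (p j)) * ENNReal.ofReal ((∑ i, (r i)⁻¹) - invTop s)) ≤
          opCharRS W p r s) ∧
      (invExp (harm p) ≠ invTop s →
        matrixFW (fun x => tensorMatrix fun j => W j x) (expOf (invExp (harm p) - invTop s)) ≤
          (((4 : NNReal) ^ (invExp (harm p) - invTop s) : NNReal) : ℝ≥0∞) * opCharRS W p r s) ∧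
      (∀ j, p j ≠ ENNReal.ofReal (r j) →
        matrixFW (fun x => (W j x)⁻¹) (expOf ((r j)⁻¹ - invExp (p j))) ≤
          (((4 : NNReal) ^ (∑ j, (r j)⁻¹) : NNReal) : ℝ≥0∞) * opCharRS W p r s) := by
  have hp0 : ∀ j, p j ≠ 0 := fun j => ((ENNReal.ofReal_pos.2 (hr j)).trans_le (hpr j)).ne'
  have hτ : ∀ j, 0 ≤ (r j)⁻¹ - invExp (p j) := fun j =>
    sub_nonneg.2 (invExp_le_inv (hr j) (hpr j))
  have hb : 0 ≤ invExp (harm p) - invTop s := sub_nonneg.2 hs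
  have hsum : invExp (harm p) - invTop s + ∑ j, ((r j)⁻¹ - invExp (p j)) =
      (∑ j, (r j)⁻¹) - invTop s := by
    rw [Finset.sum_sub_distrib, invExp_harm hp0]
    ring
  have hpos : 0 < (∑ j, (r j)⁻¹) - invTop s := by
    refine sub_invTop_pos hm hr ?_ hrs
    -- Here 1/s ≤ 1/p ≤ 1/r; r ≠ s then makes the inequality strict.
    linarith [Finset.sum_nonneg fun j (_ : j ∈ Finset.univ) => hτ j]
  have hcoe : ∀ x : ℝ, (((4 : NNReal) ^ x : NNReal) : ℝ≥0∞) = 4 ^ x := fun x => by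
    rw [ENNReal.coe_rpow_of_ne_zero four_ne_zero]
    rfl
  obtain ⟨h1, h2, h3, h4⟩ := directional_bounds hn hW hb hτ (hsum ▸ hpos)
  rw [hsum] at h1 h2
  refine ⟨h1, fun j => ?_, fun hne => ?_, fun j hj => ?_⟩
  · have := h2 j
    rwa [← expOf_mul_ofReal hpos, div_mul_cancel₀ _ hpos.ne'] at this
  · rw [hcoe]
    exact h3 (lt_of_le_of_ne hb (sub_ne_zero.2 hne).symm)
  · rw [hcoe]
    refine (h4 j (lt_of_le_of_ne (hτ j) (sub_ne_zero.2
      (invExp_ne_inv (hr j) (hpr j) hj).symm).symm)).trans (mul_le_mul' ?_ le_rfl)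
    -- The exponent 1/t_j is at most 1/r_j, hence at most the full sum, so the constant can be
    -- chosen independently of j.
    refine ENNReal.rpow_le_rpow_of_exponent_le (by norm_num) ?_
    exact (sub_le_self _ (invExp_nonneg _)).trans (Finset.single_le_sum
      (f := fun i => (r i)⁻¹) (fun i _ => (inv_pos.2 (hr i)).le) (Finset.mem_univ j))

end Assembly

end MatrixWeights

end

open MatrixWeights in
theorem mainTheorem8 :
    -- the general bounds, with parameters `r` and `s`
    (∃ (C₁ : (m : ℕ) → (Fin m → ℝ) → WithTop ℝ → (Fin m → ℕ) → NNReal)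
       (C₂ : ℝ → WithTop ℝ → ENNReal → NNReal)
       (C₃ : (m : ℕ) → (Fin m → ℝ) → WithTop ℝ → (Fin m → ℕ) → ENNReal → NNReal),
      ∀ (𝕜 : Type) [RCLike 𝕜] (d m : ℕ), 0 < d → 0 < m →
      ∀ (n : Fin m → ℕ), (∀ j, 0 < n j) →
      ∀ (p : Fin m → ENNReal) (r : Fin m → ℝ) (s : WithTop ℝ),
      (∀ j, 0 < r j) → s ≠ 0 → (∀ j, ENNReal.ofReal (r j) ≤ p j) →
      invTop s ≤ invExp (harm p) → (((∑ j, (r j)⁻¹)⁻¹ : ℝ) : WithTop ℝ) ≠ s →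
      ∀ (W : ∀ j, (Fin d → ℝ) → Matrix (Fin (n j)) (Fin (n j)) 𝕜),
      (∀ j, IsMatrixWeight (W j)) → opCharRS W p r s < ⊤ →
      ∀ (ρ : ℝ) (q κ : ENNReal) (t lam : Fin m → ENNReal),
      ρ = ((∑ j, (r j)⁻¹) - invTop s)⁻¹ →
      q = expOf (invExp (harm p) - invTop s) →
      κ = expOf ((invExp (harm p) - invTop s) / ((∑ j, (r j)⁻¹) - invTop s)) →
      (∀ j, t j = expOf ((r j)⁻¹ - invExp (p j))) →
      (∀ j, lam j = t j * ENNReal.ofReal ((∑ i, (r i)⁻¹) - invTop s)) →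
        directionalChar (fun x => tensorMatrix fun j => W j x) ρ κ ≤ opCharRS W p r s ∧
        (∀ j, directionalChar (fun x => (W j x)⁻¹) ρ (lam j) ≤
          C₁ m r s n * opCharRS W p r s) ∧
        (invExp (harm p) ≠ invTop s →
          matrixFW (fun x => tensorMatrix fun j => W j x) q ≤
            C₂ ((∑ j, (r j)⁻¹)⁻¹) s (harm p) * opCharRS W p r s) ∧
        (∀ j, p j ≠ ENNReal.ofReal (r j) →
          matrixFW (fun x => (W j x)⁻¹) (t j) ≤
            C₃ m r s n (p j) * opCharRS W p r s)) ∧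
    -- the bounds for the multilinear matrix Muckenhoupt class
    (∃ (D₁ : (m : ℕ) → (Fin m → ℕ) → NNReal)
       (D₂ : ℕ → ENNReal → NNReal)
       (D₃ : ℕ → (m : ℕ) → (Fin m → ℕ) → ENNReal → NNReal),
      ∀ (𝕜 : Type) [RCLike 𝕜] (d m : ℕ), 0 < d → 0 < m →
      ∀ (n : Fin m → ℕ), (∀ j, 0 < n j) →
      ∀ (p : Fin m → ENNReal), (∀ j, 1 ≤ p j) →
      ∀ (W : ∀ j, (Fin d → ℝ) → Matrix (Fin (n j)) (Fin (n j)) 𝕜),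
      (∀ j, IsMatrixWeight (W j)) → IsMuckenhoupt W p →
        opCharP W p < ⊤ ∧
        directionalChar (fun x => tensorMatrix fun j => W j x) ((m : ℝ)⁻¹) (m * harm p) ≤
          opCharP W p ∧
        (∀ j, directionalChar (fun x => (W j x)⁻¹) ((m : ℝ)⁻¹) (m * (p j).conjExponent) ≤
          D₁ m n * opCharP W p) ∧
        (harm p ≠ ⊤ →
          matrixFW (fun x => tensorMatrix fun j => W j x) (harm p) ≤
            D₂ m (harm p) * opCharP W p) ∧
        (∀ j, 1 < p j →
          matrixFW (fun x => (W j x)⁻¹) (p j).conjExponent ≤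
            D₃ d m n (p j) * opCharP W p)) := by
  -- The directional constants are 1; the Fujii–Wilson constants are powers of Doob's 4. In (B), ∑
  -- 1/r_j = m.
  refine ⟨⟨fun _ _ _ _ => 1, fun _ s p => 4 ^ (invExp p - invTop s),
    fun m r _ _ _ => 4 ^ (∑ j, (r j)⁻¹), ?_⟩, ⟨fun _ _ => 1, fun _ p => 4 ^ invExp p,
    fun _ m _ _ => 4 ^ (m : ℝ), ?_⟩⟩
  · intro 𝕜 _ d m _ hm n hn p r s hr _ hpr hs hrs W hW _ ρ q κ t lam hρ hq hκ ht hlam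
    subst hρ hq hκ
    obtain rfl := funext ht
    obtain rfl := funext hlam
    simpa only [ENNReal.coe_one, one_mul] using opCharRS_bounds hm hn hr hpr hs hrs hW
  · intro 𝕜 _ d m _ hm n hn p hp W hW hA
    have hp0 : ∀ j, p j ≠ 0 := fun j => (one_pos.trans_le (hp j)).ne'
    have hm' : (0 : ℝ) < m := Nat.cast_pos.2 hm
    have htop : invTop ⊤ = 0 := rfl
    have hsum : ∑ _j : Fin m, (1 : ℝ)⁻¹ = m := by simp
    have hharm : expOf (invExp (harm p)) = harm p := expOf_invExp (harm_ne_zero hp0)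
    have hconj : ∀ j, expOf ((1 : ℝ)⁻¹ - invExp (p j)) = (p j).conjExponent := fun j => by
      rw [inv_one, conjExponent_eq_expOf (hp j)]
    have hκ : expOf (invExp (harm p) / m) = m * harm p := by
      rw [← expOf_mul_ofReal (a := invExp (harm p) / m) hm', div_mul_cancel₀ _ hm'.ne', hharm,
        ENNReal.ofReal_natCast, mul_comm]
    have h := opCharRS_bounds (W := W) (p := p) (r := fun _ => 1) (s := ⊤) hm hn
      (fun _ => one_pos) (fun j => by simpa using hp j) (htop ▸ invExp_nonneg _)
      (WithTop.coe_ne_top) hW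
    simp only [htop, sub_zero, hsum, hharm, hκ, hconj, ENNReal.ofReal_natCast,
      ENNReal.ofReal_one] at h
    obtain ⟨h1, h2, h3, h4⟩ := h
    refine ⟨?_, h1, fun j => ?_, fun hne => h3 fun h0 => hne ?_, fun j hj => h4 j hj.ne'⟩
    · have := hA.opChar_lt_top hW hp
      simpa only [opCharP, opCharRS, htop, sub_zero, hharm, inv_one] using this
    · rw [ENNReal.coe_one, one_mul, mul_comm]
      exact h2 j
    · rw [← hharm, h0, expOf_zero]
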